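/- Let $T=V/\Lambda$ be a complex torus of dimension $g>2$, where $V$ is a $g$-dimensional complex vector space and $\Lambda$ is a discrete lattice of rank $2g$ in $V$. Put $\Lambda_{\mathbb Q}=\Lambda\otimes\mathbb Q=H_1(T,\mathbb Q)$, identify $\Lambda_{\mathbb Q}\otimes_{\mathbb Q}\mathbb R$ with $V$, and let $\mathrm{End}^0(T)=\mathrm{End}_{\mathbb Q}(\Lambda_{\mathbb Q})\cap\mathrm{End}_{\mathbb C}(V)$ be the endomorphism algebra of $T$. The torus $T$ is called $2$-simple if every rational Hodge substructure $H$ of $H^2(T,\mathbb Q)=\mathrm{Hom}_{\mathbb Q}(\wedge^2_{\mathbb Q}\Lambda_{\mathbb Q},\mathbb Q)$ with $(H\otimes_{\mathbb Q}\mathbb C)\cap H^{2,0}(T)\neq\{0\}$ satisfies $H\otimes_{\mathbb Q}\mathbb C\supset H^{2,0}(T)$. The Hodge group $\mathrm{Hdg}(T)$ is the smallest algebraic $\mathbb Q$-subgroup $G$ of $\mathrm{GL}(\Lambda_{\mathbb Q})$ such that $G(\mathbb R)\subset\mathrm{Aut}_{\mathbb R}(V)$ contains multiplication by $z$ for every complex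 number $z$ with $|z|=1$; its Lie algebra is denoted $\mathrm{hdg}_T\subset\mathrm{End}_{\mathbb Q}(\Lambda_{\mathbb Q})$. (1) Suppose that $T$ is $2$-simple and that $\mathrm{End}^0(T)$ is a number field $E$ of degree $g$ over $\mathbb Q$. Then $$\mathrm{Hdg}(T)=\mathrm{Res}_{E/\mathbb Q}\,\mathrm{SL}(H_1(T,\mathbb Q)/E)$$ as algebraic $\mathbb Q$-subgroups of $\mathrm{GL}(\Lambda_{\mathbb Q})$, where $\mathrm{SL}(H_1(T,\mathbb Q)/E)$ is the special linear group of the $E$-vector space $H_1(T,\mathbb Q)$ and $\mathrm{Res}_{E/\mathbb Q}$ is the Weil restriction of scalars; and $$\mathrm{hdg}_T=\mathfrak{sl}(H_1(T,\mathbb Q)/E),$$ the Lie algebra of $E$-linear operators of $E$-trace zero in $H_1(T,\mathbb Q)$. (2) Let $g$ be a positive integer, $k$ a field of characteristic $0$, $W$ a $2g$-dimensional vector space over $k$, and $\mathfrak g\subset\mathrm{End}_k(W)$ a semisimple $k$-Lie subalgebra whose centralizer $K=\mathrm{End}_{\mathfrak g}(W)$ in $\mathrm{End}_k(W)$ is a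 field with $[K:k]=g$. Then $\mathfrak g$ coincides with the Lie algebra $\mathfrak{sl}(W/K)$ of $K$-linear operators of $K$-trace zero in $W$. -/

import Mathlib

open scoped TensorProduct

attribute [local instance] LieRing.ofAssociativeRing

noncomputable section

/-! ## Linear algebraic groups over `ℚ` -/

namespace QGroup

section

variable {W : Type*} [AddCommGroup W] [Module ℚ W] [Module.Finite ℚ W]

/-- The `(i, j)` entry of an `R`-linear automorphism of `R ⊗ W` in (the base change of) a fixed
`ℚ`-basis of `W`. -/
def entry (R : Type) [CommRing R] [Algebra ℚ R]
    (u : LinearMap.GeneralLinearGroup R (R ⊗[ℚ] W))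
    (ij : Fin (Module.finrank ℚ W) × Fin (Module.finrank ℚ W)) : R :=
  LinearMap.toMatrix ((Module.finBasis ℚ W).baseChange R) ((Module.finBasis ℚ W).baseChange R)
    (u : (R ⊗[ℚ] W) →ₗ[R] (R ⊗[ℚ] W)) ij.1 ij.2

variable (W) in
/-- An algebraic `ℚ`-subgroup `G` of `GL(W)` (a closed subgroup scheme), given by its functor of
points: for every commutative `ℚ`-algebra `R` a subgroup `G(R)` of `GL(R ⊗ W)`, such that all
`G(R)` are cut out in `GL(R ⊗ W)` by one and the same set of polynomial equations with rational
coefficients in the matrix entries. -/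
structure AlgSubgroup where
  pts : ∀ (R : Type) [CommRing R] [Algebra ℚ R],
    Subgroup (LinearMap.GeneralLinearGroup R (R ⊗[ℚ] W))
  isClosed : ∃ S : Set (MvPolynomial
      (Fin (Module.finrank ℚ W) × Fin (Module.finrank ℚ W)) ℚ),
    ∀ (R : Type) [CommRing R] [Algebra ℚ R]
      (u : LinearMap.GeneralLinearGroup R (R ⊗[ℚ] W)),
      u ∈ pts R ↔ ∀ p ∈ S, MvPolynomial.aeval (entry R u) p = 0

/-- The intersection of a family of algebraic subgroups of `GL(W)`. -/
def AlgSubgroup.sInf (𝒢 : Set (AlgSubgroup W)) : AlgSubgroup W where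
  pts R _ _ := ⨅ G ∈ 𝒢, G.pts R
  isClosed := by
    refine ⟨⋃ G ∈ 𝒢, G.isClosed.choose, fun R _ _ u => ?_⟩
    simp only [Subgroup.mem_iInf, Set.mem_iUnion]
    constructor
    · rintro h p ⟨G, hG, hp⟩
      exact (G.isClosed.choose_spec R u).1 (h G hG) p hp
    · intro h G hG
      exact (G.isClosed.choose_spec R u).2 fun p hp => h p ⟨G, hG, hp⟩

/-- The Lie algebra of an algebraic subgroup `G` of `GL(W)`, inside `End_ℚ(W)`: all `X` such that
`1 + εX` is a point of `G` over the dual numbers `ℚ[ε]`. -/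
def AlgSubgroup.lie (G : AlgSubgroup W) : Set (Module.End ℚ W) :=
  {X | ∃ u ∈ G.pts (DualNumber ℚ),
    (u : Module.End (DualNumber ℚ) (DualNumber ℚ ⊗[ℚ] W)) =
      1 + (DualNumber.eps : DualNumber ℚ) • X.baseChange (DualNumber ℚ)}

end

section Weil

variable (E W : Type*) [Field E] [Algebra ℚ E] [AddCommGroup W] [Module ℚ W] [Module E W]
  [IsScalarTower ℚ E W]

/-- The action of `R ⊗ E` on `R ⊗ W`: `(r ⊗ e) (s ⊗ w) = rs ⊗ ew`. -/
def tensorAction (R : Type) [CommRing R] [Algebra ℚ R] :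
    R ⊗[ℚ] E →ₐ[R] Module.End R (R ⊗[ℚ] W) :=
  Algebra.TensorProduct.lift (Algebra.ofId R _)
    ((Module.End.baseChangeHom ℚ R W).comp (Algebra.lsmul ℚ ℚ W))
    (fun r _ => Algebra.commutes r _)

/-- `R ⊗ W` as a module over `R ⊗ E`. It is free, of rank `dim_E W`, if this is finite. -/
abbrev tensorModule (R : Type) [CommRing R] [Algebra ℚ R] : Module (R ⊗[ℚ] E) (R ⊗[ℚ] W) :=
  Module.compHom _ (tensorAction E W R).toRingHom

/-- The `R`-points of the Weil restriction `Res_{E/ℚ} SL(W/E)`: the `(R ⊗ E)`-linear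
automorphisms of `R ⊗ W` whose determinant over `R ⊗ E` is `1`. -/
def resSL (R : Type) [CommRing R] [Algebra ℚ R] :
    Subgroup (LinearMap.GeneralLinearGroup R (R ⊗[ℚ] W)) :=
  letI := tensorModule E W R
  { carrier := {u | ∃ v : (R ⊗[ℚ] W) →ₗ[R ⊗[ℚ] E] (R ⊗[ℚ] W),
      (∀ x, v x = (u : (R ⊗[ℚ] W) →ₗ[R] (R ⊗[ℚ] W)) x) ∧ LinearMap.det v = 1}
    one_mem' := ⟨LinearMap.id, fun _ => rfl, LinearMap.det_id⟩
    mul_mem' := by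
      rintro a b ⟨v, hv, hv1⟩ ⟨w, hw, hw1⟩
      refine ⟨v ∘ₗ w, fun x => ?_, by rw [LinearMap.det_comp, hv1, hw1, one_mul]⟩
      rw [LinearMap.comp_apply, hv, hw]
      rfl
    inv_mem' := by
      rintro a ⟨v, hv, hv1⟩
      have h1 : ∀ x, (a : (R ⊗[ℚ] W) →ₗ[R] (R ⊗[ℚ] W))
          (((a⁻¹ : LinearMap.GeneralLinearGroup R (R ⊗[ℚ] W)) :
            (R ⊗[ℚ] W) →ₗ[R] (R ⊗[ℚ] W)) x) = x := fun x =>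
        LinearMap.congr_fun (Units.mul_inv a) x
      have h2 : ∀ x, ((a⁻¹ : LinearMap.GeneralLinearGroup R (R ⊗[ℚ] W)) :
            (R ⊗[ℚ] W) →ₗ[R] (R ⊗[ℚ] W))
          ((a : (R ⊗[ℚ] W) →ₗ[R] (R ⊗[ℚ] W)) x) = x := fun x =>
        LinearMap.congr_fun (Units.inv_mul a) x
      let w : (R ⊗[ℚ] W) →ₗ[R ⊗[ℚ] E] (R ⊗[ℚ] W) :=
        { toFun := fun x => ((a⁻¹ : LinearMap.GeneralLinearGroup R (R ⊗[ℚ] W)) :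
            (R ⊗[ℚ] W) →ₗ[R] (R ⊗[ℚ] W)) x
          map_add' := fun x y => map_add _ x y
          map_smul' := fun c x => by
            have h3 : c • x = (a : (R ⊗[ℚ] W) →ₗ[R] (R ⊗[ℚ] W)) (c •
                (((a⁻¹ : LinearMap.GeneralLinearGroup R (R ⊗[ℚ] W)) :
                  (R ⊗[ℚ] W) →ₗ[R] (R ⊗[ℚ] W)) x)) := by
              rw [← hv, map_smul, hv, h1]
            rw [h3, h2]
            rfl }
      refine ⟨w, fun x => rfl, ?_⟩
      have h4 : v ∘ₗ w = LinearMap.id := LinearMap.ext fun x => (hv _).trans (h1 x)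
      have h5 := congrArg LinearMap.det h4
      rwa [LinearMap.det_comp, hv1, one_mul, LinearMap.det_id] at h5 }

end Weil

end QGroup

/-- `sl(W/K)`: the `K`-linear operators of `K`-trace zero in `W`, as a Lie algebra over a
subfield `k` of `K`. -/
def slOver (k K W : Type*) [Field k] [Field K] [Algebra k K] [AddCommGroup W] [Module k W]
    [Module K W] [IsScalarTower k K W] : LieSubalgebra k (Module.End k W) where
  carrier := {u | ∃ v : W →ₗ[K] W, v.restrictScalars k = u ∧ LinearMap.trace K W v = 0}
  zero_mem' := ⟨0, rfl, map_zero _⟩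
  add_mem' := by
    rintro _ _ ⟨v, rfl, hv⟩ ⟨w, rfl, hw⟩
    exact ⟨v + w, rfl, by rw [map_add, hv, hw, add_zero]⟩
  smul_mem' := by
    rintro c _ ⟨v, rfl, hv⟩
    refine ⟨algebraMap k K c • v, ?_, by rw [map_smul, hv, smul_zero]⟩
    ext x
    simp
  lie_mem' := by
    rintro _ _ ⟨v, rfl, _⟩ ⟨w, rfl, _⟩
    refine ⟨v * w - w * v, rfl, ?_⟩
    rw [map_sub, LinearMap.trace_mul_comm, sub_self]

/-! ## Complex tori

The complex torus `T = V/Λ` is given by a complex vector space `V` of finite dimension and a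
lattice `Λ` in `V`. -/

namespace ComplexTorus

variable {V : Type*} [NormedAddCommGroup V] [NormedSpace ℂ V] [FiniteDimensional ℂ V]
  (Λ : Submodule ℤ V) [DiscreteTopology Λ] [IsZLattice ℝ Λ]

/-- `H₁(T, ℚ) = Λ_ℚ = Λ ⊗ ℚ`. -/
abbrev H1Q : Type _ := ℚ ⊗[ℤ] Λ

/-- `H₁(T, ℝ) = Λ_ℝ = Λ_ℚ ⊗ ℝ`. -/
abbrev H1R : Type _ := ℝ ⊗[ℚ] H1Q Λ

/-- `H₁(T, ℂ) = Λ_ℂ = Λ_ℚ ⊗ ℂ`. -/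
abbrev H1C : Type _ := ℂ ⊗[ℚ] H1Q Λ

/-- The canonical map `Λ_ℝ → V`, `r ⊗ (q ⊗ l) ↦ (r q) l`. -/
def realMap : H1R Λ →ₗ[ℝ] V :=
  Λ.subtype.liftBaseChange ℝ ∘ₗ
    (TensorProduct.AlgebraTensorModule.cancelBaseChange ℤ ℚ ℝ ℝ Λ).toLinearMap

theorem realMap_bijective : Function.Bijective (realMap Λ) := by
  have h : Function.Bijective (Λ.subtype.liftBaseChange ℝ) := by
    let b := Module.Free.chooseBasis ℤ Λ
    let e : ℝ ⊗[ℤ] Λ ≃ₗ[ℝ] V :=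
      (b.baseChange ℝ).equiv (b.ofZLatticeBasis ℝ Λ) (Equiv.refl _)
    have he : Λ.subtype.liftBaseChange ℝ = e.toLinearMap := by
      refine (b.baseChange ℝ).ext fun i => ?_
      rw [LinearEquiv.coe_coe, Module.Basis.equiv_apply]
      simp [Module.Basis.baseChange_apply]
    rw [he]
    exact e.bijective
  exact h.comp (TensorProduct.AlgebraTensorModule.cancelBaseChange ℤ ℚ ℝ ℝ Λ).bijective

/-- The canonical isomorphism `Λ_ℝ = V` of real vector spaces. -/
def realEquiv : H1R Λ ≃ₗ[ℝ] V := LinearEquiv.ofBijective (realMap Λ) (realMap_bijective Λ)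

/-- The complex structure of `V = Λ_ℝ`: multiplication by `z ∈ ℂ` as an operator in `Λ_ℝ`. -/
def mulC : ℂ →ₐ[ℝ] Module.End ℝ (H1R Λ) :=
  ((realEquiv Λ).symm.conjAlgEquiv ℝ).toAlgHom.comp (Algebra.lsmul ℝ ℝ V)

/-- The homomorphism `h : ℂ^* → Aut_ℝ(Λ_ℝ)`. -/
def h : ℂˣ →* LinearMap.GeneralLinearGroup ℝ (H1R Λ) :=
  Units.map (mulC Λ : ℂ →* Module.End ℝ (H1R Λ))

/-- The endomorphism algebra `End⁰(T) = End_ℚ(Λ_ℚ) ∩ End_ℂ(V)`, i.e. the algebra of all operators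
in `Λ_ℚ` whose extension to `Λ_ℝ = V` is `ℂ`-linear. -/
def End0 : Subalgebra ℚ (Module.End ℚ (H1Q Λ)) where
  carrier := {u | ∀ z : ℂ, u.baseChange ℝ * mulC Λ z = mulC Λ z * u.baseChange ℝ}
  mul_mem' := by
    intro a b ha hb z
    rw [LinearMap.baseChange_mul, mul_assoc, hb z, ← mul_assoc, ha z, mul_assoc]
  add_mem' := by
    intro a b ha hb z
    rw [LinearMap.baseChange_add, add_mul, mul_add, ha z, hb z]
  algebraMap_mem' := by
    intro c z
    have hc : (algebraMap ℚ (Module.End ℚ (H1Q Λ)) c).baseChange ℝ =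
        algebraMap ℝ (Module.End ℝ (H1R Λ)) (c : ℝ) := by
      ext x
      simp [Algebra.algebraMap_eq_smul_one, TensorProduct.smul_tmul']
    rw [hc]
    exact Algebra.commutes _ _

/-- The operator `J` (multiplication by `i`) in `Λ_ℝ = V`, extended `ℂ`-linearly to `Λ_ℂ`. -/
def JC : Module.End ℂ (H1C Λ) :=
  let e := TensorProduct.AlgebraTensorModule.cancelBaseChange ℚ ℝ ℂ ℂ (H1Q Λ)
  e.toLinearMap ∘ₗ (mulC Λ Complex.I).baseChange ℂ ∘ₗ e.symm.toLinearMap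

/-- `H_{-1,0}(T)`, the eigenspace of `J` in `Λ_ℂ` with eigenvalue `i`. -/
def Hm10 : Submodule ℂ (H1C Λ) := (JC Λ).eigenspace Complex.I

/-- `H_{0,-1}(T)`, the eigenspace of `J` in `Λ_ℂ` with eigenvalue `-i`. -/
def H0m1 : Submodule ℂ (H1C Λ) := (JC Λ).eigenspace (-Complex.I)

/-- `H²(T, k) = Hom_k(∧²_k M, k)` for `M = H₁(T, k)`: the alternating bilinear forms on `M`. -/
def altForms (k M : Type*) [Field k] [AddCommGroup M] [Module k M] :
    Submodule k (LinearMap.BilinForm k M) where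
  carrier := {B | B.IsAlt}
  zero_mem' := fun _ => rfl
  add_mem' := fun {A B} hA hB x => by
    rw [LinearMap.add_apply, LinearMap.add_apply, hA x, hB x, add_zero]
  smul_mem' := fun c B hB x => by
    rw [LinearMap.smul_apply, LinearMap.smul_apply, hB x, smul_zero]

/-- `H^{2,0}(T) = Hom_ℂ(∧² H_{-1,0}(T), ℂ)`, as a subspace of `H²(T, ℂ)`. -/
def H20 : Submodule ℂ (LinearMap.BilinForm ℂ (H1C Λ)) where
  carrier := {B | B ∈ altForms ℂ (H1C Λ) ∧ ∀ x ∈ H0m1 Λ, ∀ y, B x y = 0}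
  zero_mem' := ⟨zero_mem _, fun _ _ _ => rfl⟩
  add_mem' := fun {A B} hA hB => ⟨add_mem hA.1 hB.1, fun x hx y => by
    rw [LinearMap.add_apply, LinearMap.add_apply, hA.2 x hx y, hB.2 x hx y, add_zero]⟩
  smul_mem' := fun c B hB => ⟨Submodule.smul_mem _ c hB.1, fun x hx y => by
    rw [LinearMap.smul_apply, LinearMap.smul_apply, hB.2 x hx y, smul_zero]⟩

/-- `H^{0,2}(T) = Hom_ℂ(∧² H_{0,-1}(T), ℂ)`, as a subspace of `H²(T, ℂ)`. -/
def H02 : Submodule ℂ (LinearMap.BilinForm ℂ (H1C Λ)) where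
  carrier := {B | B ∈ altForms ℂ (H1C Λ) ∧ ∀ x ∈ Hm10 Λ, ∀ y, B x y = 0}
  zero_mem' := ⟨zero_mem _, fun _ _ _ => rfl⟩
  add_mem' := fun {A B} hA hB => ⟨add_mem hA.1 hB.1, fun x hx y => by
    rw [LinearMap.add_apply, LinearMap.add_apply, hA.2 x hx y, hB.2 x hx y, add_zero]⟩
  smul_mem' := fun c B hB => ⟨Submodule.smul_mem _ c hB.1, fun x hx y => by
    rw [LinearMap.smul_apply, LinearMap.smul_apply, hB.2 x hx y, smul_zero]⟩

/-- `H^{1,1}(T) = Hom_ℂ(H_{-1,0}(T), ℂ) ∧ Hom_ℂ(H_{0,-1}(T), ℂ)`, as a subspace of `H²(T, ℂ)`: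
the alternating forms that vanish on `H_{-1,0} × H_{-1,0}` and on `H_{0,-1} × H_{0,-1}`. -/
def H11 : Submodule ℂ (LinearMap.BilinForm ℂ (H1C Λ)) where
  carrier := {B | B ∈ altForms ℂ (H1C Λ) ∧ (∀ x ∈ Hm10 Λ, ∀ y ∈ Hm10 Λ, B x y = 0) ∧
    ∀ x ∈ H0m1 Λ, ∀ y ∈ H0m1 Λ, B x y = 0}
  zero_mem' := ⟨zero_mem _, fun _ _ _ _ => rfl, fun _ _ _ _ => rfl⟩
  add_mem' := fun {A B} hA hB => ⟨add_mem hA.1 hB.1,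
    fun x hx y hy => by
      rw [LinearMap.add_apply, LinearMap.add_apply, hA.2.1 x hx y hy, hB.2.1 x hx y hy, add_zero],
    fun x hx y hy => by
      rw [LinearMap.add_apply, LinearMap.add_apply, hA.2.2 x hx y hy, hB.2.2 x hx y hy, add_zero]⟩
  smul_mem' := fun c B hB => ⟨Submodule.smul_mem _ c hB.1,
    fun x hx y hy => by
      rw [LinearMap.smul_apply, LinearMap.smul_apply, hB.2.1 x hx y hy, smul_zero],
    fun x hx y hy => by
      rw [LinearMap.smul_apply, LinearMap.smul_apply, hB.2.2 x hx y hy, smul_zero]⟩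

/-- The complexification `H_ℂ ⊆ H²(T, ℂ)` of a `ℚ`-subspace `H` of `H²(T, ℚ)`. -/
def complexify (H : Submodule ℚ (LinearMap.BilinForm ℚ (H1Q Λ))) :
    Submodule ℂ (LinearMap.BilinForm ℂ (H1C Λ)) :=
  Submodule.span ℂ ((fun B => LinearMap.BilinForm.baseChange ℂ B) '' (H : Set _))

/-- `H` is a rational Hodge substructure of `H²(T, ℚ)`: a `ℚ`-subspace such that `H_ℂ` is the sum
of its intersections with the `H^{p,q}(T)`. -/
def IsHodgeSub (H : Submodule ℚ (LinearMap.BilinForm ℚ (H1Q Λ))) : Prop :=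
  H ≤ altForms ℚ (H1Q Λ) ∧
    complexify Λ H = (complexify Λ H ⊓ H20 Λ) ⊔ (complexify Λ H ⊓ H11 Λ) ⊔
      (complexify Λ H ⊓ H02 Λ)

/-- `T` is `2`-simple: every rational Hodge substructure `H` of `H²(T, ℚ)` such that `H_ℂ` meets
`H^{2,0}(T)` nontrivially contains `H^{2,0}(T)` after complexification. -/
def IsTwoSimple : Prop :=
  ∀ H : Submodule ℚ (LinearMap.BilinForm ℚ (H1Q Λ)), IsHodgeSub Λ H →
    complexify Λ H ⊓ H20 Λ ≠ ⊥ → H20 Λ ≤ complexify Λ H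

/-- The Hodge group `Hdg(T)`: the smallest algebraic `ℚ`-subgroup `G` of `GL(Λ_ℚ)` whose group of
real points contains the multiplications by all complex numbers `z` with `|z| = 1` in
`Λ_ℝ = V`. -/
def hodgeGroup : QGroup.AlgSubgroup (H1Q Λ) :=
  QGroup.AlgSubgroup.sInf {G | ∀ z : Circle, h Λ (Circle.toUnits z) ∈ G.pts ℝ}

end ComplexTorus

end

noncomputable section

/-! Both parts concern a Lie algebra `𝔤` over `k` of operators in a plane `W` over a finite
extension `K` of `k`, with trace zero over `K` and with commutant exactly `K`. The `K`-span of `𝔤`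
is then either all of `sl₂`, or it has a derived algebra spanned by a nilpotent `u`
(`RankTwo.eq_ker_trace_or_exists`). In the first case `𝔤` itself is `sl(W/K)`
(`RankTwo.eq_ker_trace`). Indeed `[x,[y,z]] = 2(tr(xy)z - tr(xz)y)` forces all `tr(xy)` into the
ring `F` of scalars stabilizing `𝔤`. Hence `F + 𝔤` is an associative algebra; it is semisimple with
commutant `K`, and the density theorem fills it up to `End_K(W)`.

For (2), a semisimple `𝔤` is spanned by brackets, so its traces vanish, and in the nilpotent case
`𝔤` would lie in `K u`. Then `u` would commute with `𝔤` and be a scalar, which is absurd.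

For (1), the alternating forms with `B(ex, y) = B(x, ey)` make up a Hodge substructure. If it met
`H^{2,0}`, it would contain `H^{2,0}`; then every `e` would move each rational vector within its
complex line, and two vectors would span `V`, against `g > 2`. So these forms have type `(1,1)` and
are preserved by the circle. The rational components of the `E`-determinant are among them, whence
`Hdg ⊆ Res SL`. Differentiating the circle puts `J` into the real span of `hdg`. Therefore the
commutant of `hdg` lies in `End⁰(T) = E`, and `hdg`-stable rational subspaces are subtori. In the
nilpotent case `ker u` would be a subtorus of rank at most `g`, which 2-simplicity excludes
(`ComplexTorus.eq_bot_of_isTwoSimple`). So `hdg = sl(W/E)`.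

To return from the Lie algebra to the group, square-zero tangent vectors are integrated to
one-parameter groups. These give all elementary matrices, and they generate `SL₂(R ⊗ E)` when `R` is
local; the equations of the group are then checked locally on `R` (`QGroup.resSL_le`). -/

theorem isNilpotent_of_mem_jacobson {A : Type*} [Ring A] [IsArtinianRing A] {n : A}
    (hn : n ∈ Ring.jacobson A) : IsNilpotent n := by
  obtain ⟨j, hj⟩ : IsNilpotent (Ring.jacobson A) := by
    rw [← Ideal.jacobson_bot]
    exact IsArtinianRing.isNilpotent_jacobson_bot
  have := Ideal.pow_mem_pow hn j
  rw [hj] at this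
  exact ⟨j, this⟩

/-! ### Trace zero operators in a plane. -/

namespace RankTwo

variable {K W : Type*} [Field K] [AddCommGroup W] [Module K W]

/-- Polarized Cayley–Hamilton: a trace zero operator in a plane has scalar square. -/
theorem trace_mul_add_mul (h2 : Module.finrank K W = 2) {x y : Module.End K W}
    (hx : LinearMap.trace K W x = 0) (hy : LinearMap.trace K W y = 0) :
    x * y + y * x = LinearMap.trace K W (x * y) • (1 : Module.End K W) := by
  have : Module.Finite K W := Module.finite_of_finrank_pos (by omega)
  let b := Module.finBasisOfFinrankEq K W h2
  rw [LinearMap.trace_eq_matrix_trace K b] at hx hy ⊢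
  apply (LinearMap.toMatrixAlgEquiv b).injective
  rw [LinearMap.toMatrix_mul]
  simp only [map_add, map_mul, map_smul, map_one]
  change LinearMap.toMatrix b b x * LinearMap.toMatrix b b y +
    LinearMap.toMatrix b b y * LinearMap.toMatrix b b x = _
  generalize LinearMap.toMatrix b b x = X at *
  generalize LinearMap.toMatrix b b y = Y at *
  rw [Matrix.trace_fin_two] at hx hy ⊢
  have hx' : X 1 1 = - X 0 0 := by linear_combination hx
  have hy' : Y 1 1 = - Y 0 0 := by linear_combination hy
  ext i j
  fin_cases i <;> fin_cases j <;> simp [Matrix.mul_apply, Fin.sum_univ_two, hx', hy'] <;> ring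

/-- The triple product identity of `sl₂`. It produces the scalars `tr(xy)` out of brackets alone,
which is what makes the descent from `K` to `k` possible. -/
theorem bracket_bracket (h2 : Module.finrank K W = 2) {x y z : Module.End K W}
    (hx : LinearMap.trace K W x = 0) (hy : LinearMap.trace K W y = 0)
    (hz : LinearMap.trace K W z = 0) :
    x * (y * z - z * y) - (y * z - z * y) * x =
      (2 : K) • (LinearMap.trace K W (x * y) • z - LinearMap.trace K W (x * z) • y) := by
  have e1 := trace_mul_add_mul h2 hx hy
  have e2 := trace_mul_add_mul h2 hx hz
  have a1 : LinearMap.trace K W (x * y) • z = (x * y + y * x) * z := by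
    rw [e1, smul_mul_assoc, one_mul]
  have a1' : LinearMap.trace K W (x * y) • z = z * (x * y + y * x) := by
    rw [e1, mul_smul_comm, mul_one]
  have a2 : LinearMap.trace K W (x * z) • y = (x * z + z * x) * y := by
    rw [e2, smul_mul_assoc, one_mul]
  have a2' : LinearMap.trace K W (x * z) • y = y * (x * z + z * x) := by
    rw [e2, mul_smul_comm, mul_one]
  rw [two_smul]
  nth_rewrite 1 [a1, a2]
  rw [a1', a2']
  noncomm_ring

theorem eq_zero_of_trace_mul (h2 : Module.finrank K W = 2) {x : Module.End K W}
    (h : ∀ y, LinearMap.trace K W (x * y) = 0) : x = 0 := by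
  have : Module.Finite K W := Module.finite_of_finrank_pos (by omega)
  let b := Module.finBasisOfFinrankEq K W h2
  apply (LinearMap.toMatrixAlgEquiv b).injective
  rw [map_zero]
  apply Matrix.ext_iff_trace_mul_right.2
  intro Y
  obtain ⟨y, rfl⟩ := (LinearMap.toMatrixAlgEquiv b).surjective Y
  rw [zero_mul, Matrix.trace_zero, ← map_mul]
  have := h y
  rwa [LinearMap.trace_eq_matrix_trace K b] at this

theorem trace_one (h2 : Module.finrank K W = 2) : LinearMap.trace K W 1 = 2 := by
  have : Module.Finite K W := Module.finite_of_finrank_pos (by omega)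
  rw [LinearMap.trace_one, h2]; norm_num

theorem finrank_ker_trace [CharZero K] (h2 : Module.finrank K W = 2) :
    Module.finrank K (LinearMap.ker (LinearMap.trace K W)) = 3 := by
  have : Module.Finite K W := Module.finite_of_finrank_pos (by omega)
  have h := LinearMap.finrank_range_add_finrank_ker (LinearMap.trace K W)
  have hs : LinearMap.range (LinearMap.trace K W) = ⊤ := by
    apply LinearMap.range_eq_top.2
    intro c
    refine ⟨(c / 2) • 1, ?_⟩
    rw [map_smul, trace_one h2, smul_eq_mul]
    field_simp
  rw [hs, finrank_top, Module.finrank_self, Module.finrank_linearMap, h2] at h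
  omega

theorem eq_zero_of_smul_one [CharZero K] (h2 : Module.finrank K W = 2) {x : Module.End K W} {c : K}
    (hx : LinearMap.trace K W x = 0) (h : x = c • 1) : x = 0 := by
  have h' := hx
  rw [h, map_smul, trace_one h2, smul_eq_mul] at h'
  have : c = 0 := by simpa using h'
  rw [h, this, zero_smul]

/-- A Lie algebra of trace zero operators in a plane, with scalar commutant, is either `sl₂` or has
a derived algebra spanned by a nilpotent operator. -/
theorem eq_ker_trace_or_exists [CharZero K] (h2 : Module.finrank K W = 2)
    (L : Submodule K (Module.End K W))
    (htr : ∀ x ∈ L, LinearMap.trace K W x = 0) (hbr : ∀ x ∈ L, ∀ y ∈ L, x * y - y * x ∈ L)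
    (hc : ∀ z : Module.End K W, (∀ x ∈ L, z * x = x * z) → ∃ c : K, z = c • 1) :
    L = LinearMap.ker (LinearMap.trace K W) ∨
      ∃ u ∈ L, u ≠ 0 ∧ u * u = 0 ∧ ∀ x ∈ L, ∀ y ∈ L, ∃ c : K, x * y - y * x = c • u := by
  have : Module.Finite K W := Module.finite_of_finrank_pos (by omega)
  have hle : L ≤ LinearMap.ker (LinearMap.trace K W) := fun x hx => htr x hx
  have h3 := Submodule.finrank_mono hle
  rw [finrank_ker_trace h2] at h3
  have hcent : ∀ z ∈ L, (∀ x ∈ L, z * x = x * z) → z = 0 := fun z hz h =>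
    (hc z h).elim fun c hc => eq_zero_of_smul_one h2 (htr z hz) hc
  rcases Nat.lt_or_ge (Module.finrank K L) 2 with h1 | h1
  -- In dimension at most one `L` is commutative, so its elements are central scalars of trace zero
  -- and `L = 0`. Then every operator in the plane would be scalar.
  · exfalso
    obtain ⟨v, hv⟩ := (finrank_le_one_iff (K := K) (V := L)).1 (by omega)
    have hv' : ∀ x ∈ L, ∃ c : K, c • (v : Module.End K W) = x := fun x hx => by
      obtain ⟨c, hc⟩ := hv ⟨x, hx⟩
      exact ⟨c, congrArg Subtype.val hc⟩
    have hv0 : (v : Module.End K W) = 0 := by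
      refine hcent v v.2 fun x hx => ?_
      obtain ⟨c, rfl⟩ := hv' x hx
      simp
    have hall : ∀ z : Module.End K W, ∃ c : K, z = c • 1 := fun z => hc z fun x hx => by
      obtain ⟨c, rfl⟩ := hv' x hx
      simp [hv0]
    have h4 := finrank_ker_trace (K := K) (W := W) h2
    have : LinearMap.ker (LinearMap.trace K W) = ⊥ := by
      rw [eq_bot_iff]
      intro z hz
      obtain ⟨c, hc⟩ := hall z
      exact eq_zero_of_smul_one h2 hz hc
    rw [this, finrank_bot] at h4
    omega
  rcases Nat.lt_or_ge (Module.finrank K L) 3 with h4 | h4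
  -- In dimension two the derived algebra is spanned by `u = [p, q]`. It is nonzero, since otherwise
  -- `p` would be central. As `tr(up) = tr(uq) = 0` and `u` is a combination of `p` and `q`, also
  -- `tr(u²) = 0`, so `u² = 0` by Cayley–Hamilton.
  · right
    have h5 : Module.finrank K L = 2 := by omega
    let b := Module.finBasisOfFinrankEq K L h5
    obtain ⟨p, hp⟩ : ∃ p : Module.End K W, p = (b 0).1 := ⟨_, rfl⟩
    obtain ⟨q, hq⟩ : ∃ q : Module.End K W, q = (b 1).1 := ⟨_, rfl⟩
    have hpL : p ∈ L := hp ▸ (b 0).2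
    have hqL : q ∈ L := hq ▸ (b 1).2
    have hpq : ∀ x ∈ L, ∃ c d : K, x = c • p + d • q := fun x hx => by
      refine ⟨b.repr ⟨x, hx⟩ 0, b.repr ⟨x, hx⟩ 1, ?_⟩
      have := congrArg Subtype.val (b.sum_repr ⟨x, hx⟩)
      rw [Fin.sum_univ_two] at this
      rw [hp, hq]
      exact this.symm
    have hcomm : ∀ x ∈ L, ∀ y ∈ L, ∃ c : K, x * y - y * x = c • (p * q - q * p) := by
      intro x hx y hy
      obtain ⟨c, d, rfl⟩ := hpq x hx
      obtain ⟨c', d', rfl⟩ := hpq y hy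
      refine ⟨c * d' - d * c', ?_⟩
      simp only [add_mul, mul_add, smul_mul_smul_comm, smul_sub, sub_smul]
      rw [mul_comm c' c, mul_comm c' d, mul_comm d' c, mul_comm d' d]
      abel
    have hu : p * q - q * p ∈ L := hbr p hpL q hqL
    refine ⟨p * q - q * p, hu, ?_, ?_, hcomm⟩
    · intro h0
      have : p = 0 := hcent p hpL fun x hx => by
        obtain ⟨c, hc⟩ := hcomm p hpL x hx
        rw [h0, smul_zero] at hc
        exact sub_eq_zero.1 hc
      exact b.ne_zero 0 (Subtype.ext (hp ▸ this))
    · have hpu : LinearMap.trace K W ((p * q - q * p) * p) = 0 := by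
        rw [sub_mul, map_sub, LinearMap.trace_mul_comm K (p * q) p, sub_eq_zero]
        rw [LinearMap.trace_mul_comm K (q * p) p, LinearMap.trace_mul_comm K p (p * q), mul_assoc,
          LinearMap.trace_mul_comm K p (q * p)]
      have hqu : LinearMap.trace K W ((p * q - q * p) * q) = 0 := by
        rw [sub_mul, map_sub, mul_assoc q p q, LinearMap.trace_mul_comm K q (p * q), sub_self]
      have huu : LinearMap.trace K W ((p * q - q * p) * (p * q - q * p)) = 0 := by
        obtain ⟨c, d, hcd⟩ := hpq _ hu
        nth_rewrite 2 [hcd]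
        rw [mul_add, map_add, mul_smul_comm, mul_smul_comm, map_smul, map_smul, hpu, hqu]
        simp
      have h := trace_mul_add_mul h2 (htr _ hu) (htr _ hu)
      rw [huu, zero_smul, ← two_smul K] at h
      exact (smul_eq_zero.1 h).resolve_left two_ne_zero
  · left
    exact Submodule.eq_of_le_of_finrank_le hle (by rw [finrank_ker_trace h2]; exact h4)

/-! ### Descent of `sl₂` from `K` to `k`. -/

section Core

variable {k : Type*} [Field k] [Algebra k K] [Module k W] [IsScalarTower k K W]

/-- The scalars that stabilize a `k`-subspace of `End_K(W)`. -/
def stabilizer (S : Submodule k (Module.End K W)) : Subalgebra k K where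
  carrier := {c | ∀ x ∈ S, c • x ∈ S}
  mul_mem' := fun {a b} ha hb x hx => by rw [mul_smul]; exact ha _ (hb x hx)
  add_mem' := fun {a b} ha hb x hx => by rw [add_smul]; exact S.add_mem (ha x hx) (hb x hx)
  algebraMap_mem' := fun c x hx => by rw [algebraMap_smul]; exact S.smul_mem c hx

variable (S : Submodule k (Module.End K W))

theorem smul_mem_of_two_smul_mem [CharZero K] [CharZero k] {x : Module.End K W}
    (h : (2 : K) • x ∈ S) : x ∈ S := by
  have : x = (2⁻¹ : k) • ((2 : K) • x) := by
    have h1 : (2 : K) • x = (2 : k) • x := by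
      rw [two_smul, two_smul]
    rw [h1, smul_smul, inv_mul_cancel₀ two_ne_zero, one_smul]
  rw [this]
  exact S.smul_mem _ h

variable {S} [CharZero K]

/-- The expression is `K`-linear in each argument, so vanishing on `S` would spread to its span
`sl₂`; the standard `e`, `f` give `tr([e,f]²) = 2`. The nonzero value serves as a divisor in
`trace_mem_stabilizer`. -/
theorem exists_trace_bracket_ne_zero (h2 : Module.finrank K W = 2)
    (hS : Submodule.span K (S : Set (Module.End K W)) = LinearMap.ker (LinearMap.trace K W)) :
    ∃ a ∈ S, ∃ b ∈ S, ∃ c ∈ S, ∃ d ∈ S,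
      LinearMap.trace K W ((a * b - b * a) * (c * d - d * c)) ≠ 0 := by
  by_contra! h
  have : Module.Finite K W := Module.finite_of_finrank_pos (by omega)
  have h1 : ∀ a ∈ LinearMap.ker (LinearMap.trace K W), ∀ b ∈ S, ∀ c ∈ S, ∀ d ∈ S,
      LinearMap.trace K W ((a * b - b * a) * (c * d - d * c)) = 0 := by
    intro a ha b hb c hc d hd
    rw [← hS] at ha
    induction ha using Submodule.span_induction with
    | mem x hx => exact h x hx b hb c hc d hd
    | zero => simp
    | add x y _ _ hx hy =>
      rw [add_mul, mul_add, add_sub_add_comm, add_mul, map_add, hx, hy, add_zero]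
    | smul r x _ hx =>
      rw [smul_mul_assoc, mul_smul_comm, ← smul_sub, smul_mul_assoc, map_smul, hx, smul_zero]
  have h3 : ∀ a ∈ LinearMap.ker (LinearMap.trace K W), ∀ b ∈ LinearMap.ker (LinearMap.trace K W),
      ∀ c ∈ S, ∀ d ∈ S, LinearMap.trace K W ((a * b - b * a) * (c * d - d * c)) = 0 := by
    intro a ha b hb c hc d hd
    rw [← hS] at hb
    induction hb using Submodule.span_induction with
    | mem x hx => exact h1 a ha x hx c hc d hd
    | zero => simp
    | add x y _ _ hx hy =>
      rw [add_mul, mul_add, add_sub_add_comm, add_mul, map_add, hx, hy, add_zero]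
    | smul r x _ hx =>
      rw [smul_mul_assoc, mul_smul_comm, ← smul_sub, smul_mul_assoc, map_smul, hx, smul_zero]
  have h4 : ∀ a ∈ LinearMap.ker (LinearMap.trace K W), ∀ b ∈ LinearMap.ker (LinearMap.trace K W),
      ∀ c ∈ LinearMap.ker (LinearMap.trace K W), ∀ d ∈ S,
      LinearMap.trace K W ((a * b - b * a) * (c * d - d * c)) = 0 := by
    intro a ha b hb c hc d hd
    rw [← hS] at hc
    induction hc using Submodule.span_induction with
    | mem x hx => exact h3 a ha b hb x hx d hd
    | zero => simp
    | add x y _ _ hx hy =>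
      rw [add_mul, mul_add, add_sub_add_comm, mul_add, map_add, hx, hy, add_zero]
    | smul r x _ hx =>
      rw [smul_mul_assoc, mul_smul_comm, ← smul_sub, mul_smul_comm, map_smul, hx, smul_zero]
  have h5 : ∀ a ∈ LinearMap.ker (LinearMap.trace K W), ∀ b ∈ LinearMap.ker (LinearMap.trace K W),
      ∀ c ∈ LinearMap.ker (LinearMap.trace K W), ∀ d ∈ LinearMap.ker (LinearMap.trace K W),
      LinearMap.trace K W ((a * b - b * a) * (c * d - d * c)) = 0 := by
    intro a ha b hb c hc d hd
    rw [← hS] at hd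
    induction hd using Submodule.span_induction with
    | mem x hx => exact h4 a ha b hb c hc x hx
    | zero => simp
    | add x y _ _ hx hy =>
      rw [add_mul, mul_add, add_sub_add_comm, mul_add, map_add, hx, hy, add_zero]
    | smul r x _ hx =>
      rw [smul_mul_assoc, mul_smul_comm, ← smul_sub, mul_smul_comm, map_smul, hx, smul_zero]
  let b := Module.finBasisOfFinrankEq K W h2
  let e := LinearMap.toMatrixAlgEquiv b
  have htr : ∀ M : Matrix (Fin 2) (Fin 2) K, LinearMap.trace K W (e.symm M) = M.trace := by
    intro M
    rw [LinearMap.trace_eq_matrix_trace K b]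
    exact congrArg Matrix.trace (e.apply_symm_apply M)
  have h6 := h5 (e.symm !![0, 1; 0, 0]) (by simp [htr]) (e.symm !![0, 0; 1, 0]) (by simp [htr])
    (e.symm !![0, 1; 0, 0]) (by simp [htr]) (e.symm !![0, 0; 1, 0]) (by simp [htr])
  rw [← map_mul e.symm, ← map_mul e.symm, ← map_sub e.symm, ← map_mul e.symm, htr] at h6
  simp [Matrix.trace_fin_two] at h6

variable [CharZero k]

theorem trace_bracket_mem_stabilizer (h2 : Module.finrank K W = 2)
    (htr : ∀ x ∈ S, LinearMap.trace K W x = 0) (hbr : ∀ x ∈ S, ∀ y ∈ S, x * y - y * x ∈ S)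
    {w x y : Module.End K W} (hw : w ∈ S) (hx : x ∈ S) (hy : y ∈ S) :
    LinearMap.trace K W ((w * x - x * w) * y) ∈ stabilizer S := by
  intro z hz
  have hsym : ∀ a ∈ S, ∀ b ∈ S, ∀ c ∈ S,
      LinearMap.trace K W (a * b) • c - LinearMap.trace K W (a * c) • b ∈ S := by
    intro a ha b hb c hc
    apply smul_mem_of_two_smul_mem
    rw [← bracket_bracket h2 (htr a ha) (htr b hb) (htr c hc)]
    exact hbr _ ha _ (hbr _ hb _ hc)
  have hinv : ∀ w a b : Module.End K W, LinearMap.trace K W ((w * a - a * w) * b) =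
      - LinearMap.trace K W ((w * b - b * w) * a) := by
    intro w a b
    simp only [sub_mul, map_sub]
    rw [LinearMap.trace_mul_comm K (w * b) a, LinearMap.trace_mul_comm K (b * w) a, mul_assoc w a b,
      LinearMap.trace_mul_comm K w (a * b), mul_assoc a b w, mul_assoc a w b, ← mul_assoc a w b]
    ring
  have hwx := hbr _ hw _ hx
  have hwy := hbr _ hw _ hy
  have hwz := hbr _ hw _ hz
  -- Put `T(a, b) = tr([w, a] b)`, which is antisymmetric by `hinv`. In `s2 - s3 - s1` the multiples
  -- of `x` and `y` cancel, and `2 T(x, y) z` remains.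
  have s1 := hsym _ hwy _ hx _ hz
  have s2 := hsym _ hwz _ hy _ hx
  have s3 := hsym _ hwx _ hz _ hy
  rw [hinv w y x] at s1
  rw [hinv w z y, hinv w z x] at s2
  apply smul_mem_of_two_smul_mem
  have := S.sub_mem (S.sub_mem s2 s3) s1
  convert this using 1
  module

/-- Choose brackets `e`, `f` in `S` with `tr(ef) ≠ 0`. Multiplying `[e,[x,f]] = 2(tr(ex)f -
tr(ef)x)` by `y` and taking traces expresses `tr(ef)tr(xy)` through traces already known to
stabilize `S`. The stabilizer is a field, being a subalgebra of an algebraic extension, so `tr(ef)`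
can be divided out. -/
theorem trace_mem_stabilizer [FiniteDimensional k K] (h2 : Module.finrank K W = 2)
    (htr : ∀ x ∈ S, LinearMap.trace K W x = 0) (hbr : ∀ x ∈ S, ∀ y ∈ S, x * y - y * x ∈ S)
    (hS : Submodule.span K (S : Set (Module.End K W)) = LinearMap.ker (LinearMap.trace K W))
    {x y : Module.End K W} (hx : x ∈ S) (hy : y ∈ S) :
    LinearMap.trace K W (x * y) ∈ stabilizer S := by
  obtain ⟨a, ha, b, hb, c, hc, d, hd, h0⟩ := exists_trace_bracket_ne_zero h2 hS
  have he := hbr a ha b hb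
  have hf := hbr c hc d hd
  have hT := fun {w x y} hw hx hy => trace_bracket_mem_stabilizer (w := w) (x := x) (y := y)
    h2 htr hbr hw hx hy
  have key := bracket_bracket h2 (htr _ he) (htr x hx) (htr _ hf)
  have h1 : LinearMap.trace K W ((a * b - b * a) * (c * d - d * c)) •
      LinearMap.trace K W (x * y) ∈ stabilizer S := by
    have h3 : (2 : K) * (LinearMap.trace K W ((a * b - b * a) * (c * d - d * c)) •
        LinearMap.trace K W (x * y)) =
        2 * (LinearMap.trace K W ((a * b - b * a) * x) *
          LinearMap.trace K W ((c * d - d * c) * y)) -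
        LinearMap.trace K W (((a * b - b * a) * (x * (c * d - d * c) - (c * d - d * c) * x) -
          (x * (c * d - d * c) - (c * d - d * c) * x) * (a * b - b * a)) * y) := by
      rw [key]
      generalize a * b - b * a = e
      generalize c * d - d * c = f
      rw [smul_mul_assoc, sub_mul, smul_mul_assoc, smul_mul_assoc, map_smul, map_sub,
        map_smul, map_smul]
      simp only [smul_eq_mul]
      ring
    have h4 : (2 : K) * (LinearMap.trace K W ((a * b - b * a) * (c * d - d * c)) •
        LinearMap.trace K W (x * y)) ∈ stabilizer S := by
      rw [h3]
      refine sub_mem (mul_mem (ofNat_mem _ 2) (mul_mem (hT ha hb hx) (hT hc hd hy))) ?_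
      exact hT he (hbr _ hx _ hf) hy
    intro z hz
    apply smul_mem_of_two_smul_mem
    rw [smul_smul]
    exact h4 z hz
  have h5 := (stabilizer S).inv_mem_of_algebraic (x := ⟨_, hT ha hb hf⟩)
    (Algebra.IsAlgebraic.isAlgebraic (R := k) _)
  have := mul_mem h5 h1
  rwa [smul_eq_mul, inv_mul_cancel_left₀ h0] at this

/-- If `S` is a `k`-Lie algebra of operators in a `K`-plane `W` whose `K`-span is `sl₂` and whose
commutant over `k` is `K`, then `S` is `sl₂`. -/
theorem eq_ker_trace [FiniteDimensional k K] (h2 : Module.finrank K W = 2)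
    (hbr : ∀ x ∈ S, ∀ y ∈ S, x * y - y * x ∈ S)
    (hS : Submodule.span K (S : Set (Module.End K W)) = LinearMap.ker (LinearMap.trace K W))
    (hc : ∀ z : Module.End k W, (∀ x ∈ S, ∀ w, z (x w) = x (z w)) → ∃ c : K, ∀ w, z w = c • w)
    {x : Module.End K W} (hx : LinearMap.trace K W x = 0) : x ∈ S := by
  have : Module.Finite K W := Module.finite_of_finrank_pos (by omega)
  have : Module.Finite k W := Module.Finite.trans K W
  have htr : ∀ x ∈ S, LinearMap.trace K W x = 0 := fun x hx =>
    hS.le (Submodule.subset_span hx)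
  have hT := fun {x y} hx hy => trace_mem_stabilizer (x := x) (y := y) h2 htr hbr hS hx hy
  -- The sum of the stabilizer and `S` is closed under products because `xy = ½ tr(xy) + ½ [x, y]`.
  let A : Subalgebra k (Module.End K W) :=
    { carrier := {m | ∃ c ∈ stabilizer S, ∃ x ∈ S, m = c • 1 + x}
      add_mem' := by
        rintro _ _ ⟨c, hc, x, hx, rfl⟩ ⟨d, hd, y, hy, rfl⟩
        exact ⟨c + d, add_mem hc hd, x + y, add_mem hx hy, by module⟩
      mul_mem' := by
        rintro _ _ ⟨c, hc, x, hx, rfl⟩ ⟨d, hd, y, hy, rfl⟩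
        refine ⟨c * d + algebraMap k K 2⁻¹ * LinearMap.trace K W (x * y),
          add_mem (mul_mem hc hd) (mul_mem ((stabilizer S).algebraMap_mem _) (hT hx hy)),
          c • y + d • x + (2⁻¹ : k) • (x * y - y * x),
          add_mem (add_mem (hc y hy) (hd x hx)) (S.smul_mem _ (hbr x hx y hy)), ?_⟩
        have h := trace_mul_add_mul h2 (htr x hx) (htr y hy)
        rw [add_smul, mul_smul (algebraMap k K 2⁻¹), ← h, algebraMap_smul]
        have h6 : x * y = (2⁻¹ : k) • (x * y + y * x) + (2⁻¹ : k) • (x * y - y * x) := by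
          rw [← smul_add, add_add_sub_cancel, ← two_smul k, smul_smul,
            inv_mul_cancel₀ two_ne_zero, one_smul]
        rw [add_mul, mul_add, mul_add, smul_mul_smul_comm, smul_mul_assoc, one_mul, one_mul,
          mul_smul_comm, mul_one]
        nth_rewrite 1 [h6]
        abel
      algebraMap_mem' := fun r => ⟨algebraMap k K r, (stabilizer S).algebraMap_mem r, 0, zero_mem _,
        by rw [add_zero, algebraMap_smul, Algebra.algebraMap_eq_smul_one]⟩ }
  have hSA : ∀ x ∈ S, x ∈ A := fun x hx => ⟨0, zero_mem _, x, hx, by simp⟩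
  have hspan : ∀ m : Module.End K W, m ∈ Submodule.span K (A : Set (Module.End K W)) := by
    intro m
    have h1 : m - (LinearMap.trace K W m / 2) • 1 ∈
        Submodule.span K (S : Set (Module.End K W)) := by
      rw [hS, LinearMap.mem_ker, map_sub, map_smul, trace_one h2, smul_eq_mul,
        div_mul_cancel₀ _ two_ne_zero, sub_self]
    rw [← sub_add_cancel m ((LinearMap.trace K W m / 2) • 1)]
    exact add_mem (Submodule.span_mono hSA h1)
      (Submodule.smul_mem _ _ (Submodule.subset_span A.one_mem))
  have : IsArtinianRing A := IsArtinianRing.of_finite k A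
  have : IsSemisimpleRing A := by
    rw [IsArtinianRing.isSemisimpleRing_iff_jacobson, eq_bot_iff]
    intro n hn
    -- For `n` in the radical every `an` is nilpotent, so `n` is trace-orthogonal to `A`, hence to
    -- its `K`-span `End_K(W)`. The trace form is nondegenerate.
    have h1 : ∀ a : A, LinearMap.trace K W ((n : Module.End K W) * a) = 0 := by
      intro a
      have h3 : a * n ∈ Ring.jacobson A := Ideal.mul_mem_left _ _ hn
      have h5 : IsNilpotent ((a : Module.End K W) * n) :=
        (isNilpotent_of_mem_jacobson h3).map A.subtype
      rw [LinearMap.trace_mul_comm]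
      exact (LinearMap.isNilpotent_trace_of_isNilpotent h5).eq_zero
    refine Subtype.ext (eq_zero_of_trace_mul h2 fun y => ?_)
    have hy := hspan y
    induction hy using Submodule.span_induction with
    | mem x hx => exact h1 ⟨x, hx⟩
    | zero => simp
    | add x y _ _ hx hy => rw [mul_add, map_add, hx, hy, add_zero]
    | smul r x _ hx => rw [mul_smul_comm, map_smul, hx, smul_zero]
  have hAx : ∀ (a : A) (w : W), a • w = (a : Module.End K W) w := fun _ _ => rfl
  have hEnd : ∀ f : Module.End A W, ∃ c : K, ∀ w, f w = c • w := by
    intro f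
    let z : Module.End k W :=
      { toFun := f
        map_add' := map_add f
        map_smul' := fun r w => by
          have h1 : ∀ w : W, r • w = (algebraMap k A r) • w := fun w => by
            rw [hAx, Subalgebra.coe_algebraMap, Module.algebraMap_end_apply]
          rw [RingHom.id_apply, h1, map_smul, ← h1] }
    exact hc z fun x hx w => f.map_smul (⟨x, hSA x hx⟩ : A) w
  -- The `A`-endomorphisms of the semisimple module `W` are scalars from `K`, so the `K`-linear `x`
  -- lies in the bicommutant. By density it agrees with an element of `A` on a `K`-basis, hence
  -- everywhere.
  let m : Module.End (Module.End A W) W :=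
    { toFun := x
      map_add' := map_add x
      map_smul' := fun f w => by
        obtain ⟨c, hc⟩ := hEnd f
        rw [RingHom.id_apply, Module.End.smul_def, Module.End.smul_def, hc, hc, map_smul] }
  let b := Module.finBasisOfFinrankEq K W h2
  classical
  obtain ⟨a, ha⟩ := jacobson_density m (Finset.univ.image b)
  have hax : x = a := by
    refine b.ext fun i => ?_
    exact ha (b i) (Finset.mem_image_of_mem _ (Finset.mem_univ i))
  obtain ⟨c, hc, y, hy, hcy⟩ := a.2
  rw [← hax] at hcy
  have h7 := hx
  rw [hcy, map_add, map_smul, trace_one h2, htr y hy, add_zero, smul_eq_mul] at h7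
  have : c = 0 := by simpa using h7
  rw [hcy, this, zero_smul, zero_add]
  exact hy

end Core

end RankTwo

/-! ### The dichotomy for Lie algebras with commutant `K`. -/

section Descent

variable {k K W : Type*} [Field k] [Field K] [Algebra k K] [AddCommGroup W] [Module k W]
  [Module K W] [IsScalarTower k K W]

/-- A `k`-Lie algebra of operators in a `K`-plane `W` whose commutant is `K` is either
`sl(W/K)` or has a derived algebra contained in the `K`-line of a nilpotent operator. -/
theorem eq_slOver_or_exists [CharZero k] [FiniteDimensional k K] (h2 : Module.finrank K W = 2)
    (𝔤 : Submodule k (Module.End k W)) (hbr : ∀ x ∈ 𝔤, ∀ y ∈ 𝔤, x * y - y * x ∈ 𝔤)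
    (hsl : ∀ x ∈ 𝔤, x ∈ slOver k K W)
    (hc : ∀ z : Module.End k W, (∀ x ∈ 𝔤, z * x = x * z) → ∃ c : K, ∀ w, z w = c • w) :
    (𝔤 : Set (Module.End k W)) = slOver k K W ∨
      ∃ u : Module.End K W, u ≠ 0 ∧ u * u = 0 ∧
        (∀ x ∈ 𝔤, ∃ c : K, ∀ w, x (u w) - u (x w) = c • u w) ∧
        ∀ x ∈ 𝔤, ∀ y ∈ 𝔤, ∃ c : K, ∀ w, x (y w) - y (x w) = c • u w := by
  have : CharZero K := charZero_of_injective_algebraMap (algebraMap k K).injective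
  let S : Submodule k (Module.End K W) := 𝔤.comap (LinearMap.restrictScalarsₗ k K W W k)
  have hmem : ∀ v : Module.End K W, v ∈ S ↔ v.restrictScalars k ∈ 𝔤 := fun v => Iff.rfl
  have hlift : ∀ x ∈ 𝔤, ∃ v ∈ S, v.restrictScalars k = x := fun x hx => by
    obtain ⟨v, rfl, _⟩ := hsl x hx
    exact ⟨v, hx, rfl⟩
  have htr : ∀ v ∈ S, LinearMap.trace K W v = 0 := fun v hv => by
    obtain ⟨w, hw, hw0⟩ := hsl _ hv
    have : v = w := LinearMap.ext fun a => (LinearMap.congr_fun hw a).symm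
    rwa [this]
  have hSbr : ∀ x ∈ S, ∀ y ∈ S, x * y - y * x ∈ S := fun x hx y hy => hbr _ hx _ hy
  have hSc : ∀ z : Module.End k W, (∀ x ∈ S, ∀ w, z (x w) = x (z w)) →
      ∃ c : K, ∀ w, z w = c • w := fun z hz => hc z fun x hx => by
    obtain ⟨v, hv, rfl⟩ := hlift x hx
    exact LinearMap.ext fun w => hz v hv w
  let L := Submodule.span K (S : Set (Module.End K W))
  have hLtr : ∀ x ∈ L, LinearMap.trace K W x = 0 := fun x hx =>
    (Submodule.span_le (p := LinearMap.ker (LinearMap.trace K W))).2 htr hx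
  have hLbr : ∀ x ∈ L, ∀ y ∈ L, x * y - y * x ∈ L := by
    intro x hx y hy
    induction hx using Submodule.span_induction with
    | mem x hx =>
      induction hy using Submodule.span_induction with
      | mem y hy => exact Submodule.subset_span (hSbr x hx y hy)
      | zero => simp
      | add y z _ _ hy hz => rw [mul_add, add_mul, add_sub_add_comm]; exact add_mem hy hz
      | smul c y _ hy =>
        rw [mul_smul_comm, smul_mul_assoc, ← smul_sub]; exact Submodule.smul_mem _ _ hy
    | zero => simp
    | add y z _ _ hy hz => rw [mul_add, add_mul, add_sub_add_comm]; exact add_mem hy hz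
    | smul c y _ hy =>
      rw [mul_smul_comm, smul_mul_assoc, ← smul_sub]; exact Submodule.smul_mem _ _ hy
  have hLc : ∀ z : Module.End K W, (∀ x ∈ L, z * x = x * z) → ∃ c : K, z = c • 1 := by
    intro z hz
    obtain ⟨c, hc⟩ := hSc (z.restrictScalars k) fun x hx w =>
      LinearMap.congr_fun (hz x (Submodule.subset_span hx)) w
    exact ⟨c, LinearMap.ext hc⟩
  rcases RankTwo.eq_ker_trace_or_exists h2 L hLtr hLbr hLc with h | ⟨u, huL, hu0, huu, hu⟩
  · left
    apply Set.Subset.antisymm hsl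
    rintro _ ⟨v, rfl, hv⟩
    exact RankTwo.eq_ker_trace h2 hSbr h hSc hv
  · right
    refine ⟨u, hu0, huu, ?_, ?_⟩
    · intro x hx
      obtain ⟨v, hv, rfl⟩ := hlift x hx
      obtain ⟨c, hc⟩ := hu v (Submodule.subset_span hv) u huL
      exact ⟨c, LinearMap.congr_fun hc⟩
    · intro x hx y hy
      obtain ⟨v, hv, rfl⟩ := hlift x hx
      obtain ⟨w, hw, rfl⟩ := hlift y hy
      obtain ⟨c, hc⟩ := hu v (Submodule.subset_span hv) w (Submodule.subset_span hw)
      exact ⟨c, LinearMap.congr_fun hc⟩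

end Descent

/-! ### Semisimple Lie algebras: the second statement. -/

/-- A minimal ideal is not abelian, so it equals its own bracket; the minimal ideals generate the
algebra. -/
theorem derived_eq_top_of_isSemisimple {k L : Type*} [Field k] [LieRing L] [LieAlgebra k L]
    [LieAlgebra.IsSemisimple k L] : LieAlgebra.derivedSeries k L 1 = ⊤ := by
  have key : ∀ I : LieIdeal k L, IsAtom I → I ≤ LieAlgebra.derivedSeries k L 1 := by
    intro I hI
    have h1 : ⁅I, I⁆ ≠ ⊥ := fun h =>
      LieAlgebra.IsSemisimple.non_abelian_of_isAtom I hI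
        ((LieSubmodule.lie_abelian_iff_lie_self_eq_bot I).2 h)
    have h2 : ⁅I, I⁆ = I := (hI.le_iff.1 (LieSubmodule.lie_le_right I I)).resolve_left h1
    rw [← h2]
    exact LieSubmodule.mono_lie le_top le_top
  rw [eq_top_iff, ← LieAlgebra.IsSemisimple.sSup_atoms_eq_top (R := k) (L := L)]
  exact sSup_le key

/-- Perfectness in a usable form: a linear condition on a semisimple algebra need only be tested on
brackets. It is applied to vanishing of the trace and to membership in a `K`-line. -/
theorem mem_of_bracket_mem_of_isSemisimple {k A : Type*} [Field k] [Ring A] [Algebra k A]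
    (𝔤 : LieSubalgebra k A) [LieAlgebra.IsSemisimple k 𝔤] (P : Submodule k A)
    (h : ∀ x ∈ 𝔤, ∀ y ∈ 𝔤, x * y - y * x ∈ P) {x : A} (hx : x ∈ 𝔤) : x ∈ P := by
  have h1 : (⟨x, hx⟩ : 𝔤) ∈ (LieAlgebra.derivedSeries k 𝔤 1 : LieSubalgebra k 𝔤).toSubmodule := by
    change (⟨x, hx⟩ : 𝔤) ∈ LieAlgebra.derivedSeries k 𝔤 1
    rw [derived_eq_top_of_isSemisimple]; trivial
  rw [LieAlgebra.coe_derivedSeries_one_eq] at h1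
  have h2 : Submodule.span k {⁅x, y⁆ | (x : 𝔤) (y : 𝔤)} ≤ P.comap 𝔤.toSubmodule.subtype := by
    rw [Submodule.span_le]
    rintro _ ⟨a, b, rfl⟩
    exact h a a.2 b b.2
  exact h2 h1

theorem eq_slOver_of_isSemisimple {g : ℕ} {k : Type*} [Field k] [CharZero k] {K : Type*} [Field K]
    [Algebra k K] {W : Type*} [AddCommGroup W] [Module k W] [Module K W] [IsScalarTower k K W]
    (𝔤 : LieSubalgebra k (Module.End k W)) (hg : 0 < g) (hW : Module.finrank k W = 2 * g)
    (hss : LieAlgebra.IsSemisimple k 𝔤)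
    (hcent : (Algebra.lsmul k k W : K →ₐ[k] Module.End k W).range =
        Subalgebra.centralizer k (𝔤 : Set (Module.End k W)))
    (hK : Module.finrank k K = g) : 𝔤 = slOver k K W := by
  have : CharZero K := charZero_of_injective_algebraMap (algebraMap k K).injective
  have : FiniteDimensional k K := Module.finite_of_finrank_pos (by omega)
  have : FiniteDimensional k W := Module.finite_of_finrank_pos (by omega)
  have h2 : Module.finrank K W = 2 := by
    have := Module.finrank_mul_finrank k K W
    rw [hK, hW, mul_comm 2] at this
    exact Nat.eq_of_mul_eq_mul_left hg this
  have : Module.Finite K W := Module.finite_of_finrank_pos (by omega)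
  have hlin : ∀ x ∈ 𝔤, ∃ v : Module.End K W, v.restrictScalars k = x := by
    intro x hx
    have h : ∀ (c : K) (w : W), x (c • w) = c • x w := fun c w => by
      have h1 : (Algebra.lsmul k k W c : Module.End k W) ∈
        Subalgebra.centralizer k (𝔤 : Set (Module.End k W)) := hcent ▸ ⟨c, rfl⟩
      exact LinearMap.congr_fun ((Subalgebra.mem_centralizer_iff k).1 h1 x hx) w
    exact ⟨{ x with map_smul' := h }, rfl⟩
  have hder : 𝔤 ≤ slOver k K W := fun x hx => by
    refine mem_of_bracket_mem_of_isSemisimple 𝔤 (slOver k K W).toSubmodule (fun x hx y hy => ?_) hx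
    obtain ⟨v, rfl⟩ := hlin x hx
    obtain ⟨w, rfl⟩ := hlin y hy
    refine ⟨v * w - w * v, rfl, ?_⟩
    rw [map_sub, LinearMap.trace_mul_comm, sub_self]
  have hc : ∀ z : Module.End k W, (∀ x ∈ 𝔤, z * x = x * z) → ∃ c : K, ∀ w, z w = c • w := by
    intro z hz
    have h1 : z ∈ Subalgebra.centralizer k (𝔤 : Set (Module.End k W)) :=
      (Subalgebra.mem_centralizer_iff k).2 fun x hx => (hz x hx).symm
    rw [← hcent] at h1
    obtain ⟨c, rfl⟩ := h1
    exact ⟨c, fun _ => rfl⟩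
  rcases eq_slOver_or_exists h2 𝔤.toSubmodule (fun x hx y hy => 𝔤.lie_mem hx hy)
    (fun x hx => hder hx) hc with h | ⟨u, hu0, huu, -, hu⟩
  · exact SetLike.coe_injective h
  · exfalso
    -- `P` is the line `K u`. It contains all brackets, hence `𝔤`, and `u² = 0` then makes `u`
    -- commute with `𝔤`. So `u` is a scalar, and a scalar of square zero is zero.
    let P : Submodule k (Module.End k W) := ((LinearMap.toSpanSingleton K (Module.End K W) u).range
      |>.restrictScalars k).map (LinearMap.restrictScalarsₗ k K W W k)
    have hP : ∀ x ∈ 𝔤, ∃ c : K, ∀ w, x w = c • u w := fun x hx => by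
      have : x ∈ P := by
        refine mem_of_bracket_mem_of_isSemisimple 𝔤 P (fun x hx y hy => ?_) hx
        obtain ⟨c, hc⟩ := hu x hx y hy
        exact ⟨c • u, ⟨c, rfl⟩, LinearMap.ext fun w => (hc w).symm⟩
      obtain ⟨_, ⟨c, rfl⟩, rfl⟩ := this
      exact ⟨c, fun w => rfl⟩
    have huu' : ∀ w, u (u w) = 0 := LinearMap.congr_fun huu
    obtain ⟨c, hc⟩ := hc (u.restrictScalars k) fun x hx => by
      obtain ⟨c, hc⟩ := hP x hx
      ext w
      simp [hc, huu']
    have hc' : ∀ w, u w = c • w := hc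
    by_cases hc0 : c = 0
    · exact hu0 (LinearMap.ext fun w => by rw [hc', hc0, zero_smul, LinearMap.zero_apply])
    · refine hu0 (LinearMap.ext fun w => ?_)
      have := huu' w
      rw [hc' (u w)] at this
      exact (smul_eq_zero.1 this).resolve_left hc0

set_option linter.unusedSectionVars false

/-! ### Points and tangent vectors of an algebraic group as matrices. -/

namespace QGroup

variable {W : Type*} [AddCommGroup W] [Module ℚ W] [Module.Finite ℚ W]

/-- Square matrices indexed by the fixed basis of `W`. -/
abbrev Mat (W : Type*) [AddCommGroup W] [Module ℚ W] (R : Type*) : Type _ :=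
  Matrix (Fin (Module.finrank ℚ W)) (Fin (Module.finrank ℚ W)) R

/-- The matrix of an operator in `R ⊗ W` in the fixed basis of `W`. -/
def toMat (R : Type) [CommRing R] [Algebra ℚ R] : Module.End R (R ⊗[ℚ] W) ≃ₐ[R] Mat W R :=
  LinearMap.toMatrixAlgEquiv ((Module.finBasis ℚ W).baseChange R)

theorem toMat_baseChange (R : Type) [CommRing R] [Algebra ℚ R] (X : Module.End ℚ W) :
    toMat R (X.baseChange R) =
      (LinearMap.toMatrixAlgEquiv (Module.finBasis ℚ W) X).map (algebraMap ℚ R) := by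
  ext i j
  simp [toMat, LinearMap.toMatrixAlgEquiv_apply, Module.Basis.baseChange_apply,
    Algebra.algebraMap_eq_smul_one]

/-- The entries of a matrix, as one family. -/
def entries {R : Type} (M : Mat W R)
    (ij : Fin (Module.finrank ℚ W) × Fin (Module.finrank ℚ W)) : R := M ij.1 ij.2

theorem entries_map {R R' : Type} (f : R → R') (M : Mat W R) :
    entries (M.map f) = fun ij => f (entries M ij) := rfl

theorem entry_eq (R : Type) [CommRing R] [Algebra ℚ R]
    (u : LinearMap.GeneralLinearGroup R (R ⊗[ℚ] W)) :
    entry R u = entries (toMat R (u : Module.End R (R ⊗[ℚ] W))) := rfl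

namespace AlgSubgroup

variable (G : AlgSubgroup W)

/-- The matrix `M` is an `R`-point of `G`. -/
def Mem {R : Type} [CommRing R] [Algebra ℚ R] (M : Mat W R) : Prop :=
  ∃ u ∈ G.pts R, toMat R (u : Module.End R (R ⊗[ℚ] W)) = M

theorem mem_pts_iff {R : Type} [CommRing R] [Algebra ℚ R]
    (u : LinearMap.GeneralLinearGroup R (R ⊗[ℚ] W)) :
    u ∈ G.pts R ↔ G.Mem (toMat R (u : Module.End R (R ⊗[ℚ] W))) := by
  refine ⟨fun h => ⟨u, h, rfl⟩, ?_⟩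
  rintro ⟨v, hv, h⟩
  rwa [← Units.ext ((toMat R).injective h)]

/-- Equations of `G`. -/
def eqs : Set (MvPolynomial
    (Fin (Module.finrank ℚ W) × Fin (Module.finrank ℚ W)) ℚ) := G.isClosed.choose

variable {G}

theorem mem_iff {R : Type} [CommRing R] [Algebra ℚ R] {M : Mat W R} :
    G.Mem M ↔ IsUnit M ∧ ∀ p ∈ G.eqs, MvPolynomial.aeval (entries M) p = 0 := by
  constructor
  · rintro ⟨u, hu, rfl⟩
    exact ⟨u.isUnit.map (toMat R), (G.isClosed.choose_spec R u).1 hu⟩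
  · rintro ⟨hM, h⟩
    have h1 : IsUnit ((toMat R).symm M) := hM.map (toMat R).symm
    refine ⟨h1.unit, (G.isClosed.choose_spec R _).2 ?_, ?_⟩
    · rw [entry_eq]
      simp only [IsUnit.unit_spec, AlgEquiv.apply_symm_apply]
      exact h
    · simp

theorem Mem.map {R R' : Type} [CommRing R] [Algebra ℚ R] [CommRing R'] [Algebra ℚ R']
    (φ : R →ₐ[ℚ] R') {M : Mat W R} (h : G.Mem M) : G.Mem (M.map φ) := by
  rw [mem_iff] at h ⊢
  refine ⟨h.1.map φ.mapMatrix, fun p hp => ?_⟩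
  rw [entries_map, ← MvPolynomial.comp_aeval_apply, h.2 p hp, map_zero]

/-- Equations may be tested after an injective extension of rings; invertibility may not, so it is a
separate hypothesis. -/
theorem Mem.of_injective {R R' : Type} [CommRing R] [Algebra ℚ R] [CommRing R'] [Algebra ℚ R']
    (φ : R →ₐ[ℚ] R') (hφ : Function.Injective φ) {M : Mat W R} (hM : IsUnit M)
    (h : G.Mem (M.map φ)) : G.Mem M := by
  rw [mem_iff] at h ⊢
  refine ⟨hM, fun p hp => hφ ?_⟩
  have := h.2 p hp
  rwa [entries_map, ← MvPolynomial.comp_aeval_apply, ← map_zero φ] at this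

theorem Mem.one {R : Type} [CommRing R] [Algebra ℚ R] : G.Mem (1 : Mat W R) :=
  ⟨1, one_mem _, map_one (toMat R)⟩

theorem Mem.mul {R : Type} [CommRing R] [Algebra ℚ R] {M N : Mat W R} (hM : G.Mem M)
    (hN : G.Mem N) : G.Mem (M * N) := by
  obtain ⟨u, hu, rfl⟩ := hM
  obtain ⟨v, hv, rfl⟩ := hN
  exact ⟨u * v, mul_mem hu hv, map_mul (toMat R) _ _⟩

/-- Tangent vectors at `1` with coefficients in `M`. -/
def Tangent {M : Type} [AddCommGroup M] [Module ℚ M] [Module ℚᵐᵒᵖ M] [IsCentralScalar ℚ M]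
    (G : AlgSubgroup W) (X : Mat W M) : Prop :=
  G.Mem (1 + X.map (TrivSqZeroExt.inr : M → TrivSqZeroExt ℚ M))

section

variable {M M' : Type} [AddCommGroup M] [Module ℚ M] [Module ℚᵐᵒᵖ M] [IsCentralScalar ℚ M]
  [AddCommGroup M'] [Module ℚ M'] [Module ℚᵐᵒᵖ M'] [IsCentralScalar ℚ M']

theorem inr_mul_inr (X Y : Mat W M) :
    X.map (TrivSqZeroExt.inr : M → TrivSqZeroExt ℚ M) * Y.map TrivSqZeroExt.inr = 0 := by
  ext i j : 1
  rw [Matrix.mul_apply]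
  exact Finset.sum_eq_zero fun k _ => TrivSqZeroExt.inr_mul_inr _ _ _

/-- Functoriality in the coefficient module. Applied to `ℚ`-linear maps `ℝ → ℚ`, it cuts a real
tangent vector into rational ones. -/
theorem Tangent.map (f : M →ₗ[ℚ] M') {X : Mat W M} (h : G.Tangent X) : G.Tangent (X.map f) := by
  have := Mem.map (TrivSqZeroExt.map f) h
  rw [Tangent]
  convert this using 1
  ext i j : 1
  simp [Matrix.one_apply]

theorem Tangent.add {X Y : Mat W M} (hX : G.Tangent X) (hY : G.Tangent Y) :
    G.Tangent (X + Y) := by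
  have := Mem.mul hX hY
  rw [mul_add, add_mul, add_mul, inr_mul_inr, one_mul, one_mul, mul_one, add_zero, add_assoc] at this
  rw [Tangent]
  convert this using 2
  exact Matrix.map_add _ (fun _ _ => TrivSqZeroExt.inr_add _ _ _) _ _

theorem Tangent.zero : G.Tangent (0 : Mat W M) := by
  have : (1 + (0 : Mat W M).map (TrivSqZeroExt.inr : M → TrivSqZeroExt ℚ M)) = 1 := by
    rw [Matrix.map_zero _ (TrivSqZeroExt.inr_zero _), add_zero]
  rw [Tangent, this]
  exact Mem.one

end

theorem mem_lie_iff {X : Module.End ℚ W} :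
    X ∈ G.lie ↔ G.Tangent (LinearMap.toMatrixAlgEquiv (Module.finBasis ℚ W) X) := by
  have key : toMat (DualNumber ℚ)
      (1 + (DualNumber.eps : DualNumber ℚ) • X.baseChange (DualNumber ℚ)) =
      1 + (LinearMap.toMatrixAlgEquiv (Module.finBasis ℚ W) X).map TrivSqZeroExt.inr := by
    rw [map_add, map_one, map_smul, toMat_baseChange]
    congr 1
    ext i j : 1
    simp only [Matrix.smul_apply, Matrix.map_apply, TrivSqZeroExt.algebraMap_eq_inl]
    rw [DualNumber.inr_eq_smul_eps, smul_eq_mul, mul_comm, ← TrivSqZeroExt.algebraMap_eq_inl,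
      Algebra.smul_def]
  constructor
  · rintro ⟨u, hu, h⟩
    exact ⟨u, hu, by rw [h, key]⟩
  · rintro ⟨u, hu, h⟩
    exact ⟨u, hu, (toMat _).injective (by rw [h, key])⟩

theorem zero_mem_lie : (0 : Module.End ℚ W) ∈ G.lie := by
  rw [mem_lie_iff, map_zero]
  exact Tangent.zero

theorem add_mem_lie {X Y : Module.End ℚ W} (hX : X ∈ G.lie) (hY : Y ∈ G.lie) : X + Y ∈ G.lie := by
  rw [mem_lie_iff] at *
  rw [map_add]
  exact hX.add hY

theorem smul_mem_lie (c : ℚ) {X : Module.End ℚ W} (hX : X ∈ G.lie) : c • X ∈ G.lie := by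
  rw [mem_lie_iff] at *
  rw [map_smul]
  exact hX.map (LinearMap.lsmul ℚ ℚ c)

/-- The dual numbers are universal for elements of square zero: specialize `ε` to `a`. -/
theorem Tangent.mem_of_mul_self {X : Mat W ℚ} (hX : G.Tangent X) {R : Type} [CommRing R]
    [Algebra ℚ R] {a : R} (ha : a * a = 0) : G.Mem (1 + a • X.map (algebraMap ℚ R)) := by
  have := Mem.map (DualNumber.lift ⟨(Algebra.ofId ℚ R, a), ha, fun r => mul_comm _ _⟩) hX
  convert this using 1
  ext i j : 1
  simp only [Matrix.add_apply, Matrix.smul_apply, Matrix.map_apply, map_add, smul_eq_mul]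
  congr 1
  · rw [Matrix.one_apply, Matrix.one_apply]; split_ifs <;> simp
  · rw [DualNumber.inr_eq_smul_eps, map_smul, DualNumber.lift_apply_eps, Algebra.smul_def, mul_comm]

theorem isUnit_one_add_inr {M : Type} [AddCommGroup M] [Module ℚ M] [Module ℚᵐᵒᵖ M]
    [IsCentralScalar ℚ M] (X : Mat W M) :
    IsUnit (1 + X.map (TrivSqZeroExt.inr : M → TrivSqZeroExt ℚ M)) :=
  ⟨⟨1 + X.map TrivSqZeroExt.inr, 1 - X.map TrivSqZeroExt.inr,
    by rw [mul_sub, mul_one, add_mul, inr_mul_inr]; simp,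
    by rw [sub_mul, one_mul, mul_add, inr_mul_inr]; simp⟩, rfl⟩

/-- This is the group commutator of `1 + ax` and `1 + by`; `a² = b² = 0` kills every term except `1`
and `ab[x, y]`. The inverses come from the tangent vectors `-x` and `-y`. -/
theorem Tangent.commutator_mem {x y : Mat W ℚ} (hx : G.Tangent x) (hy : G.Tangent y) {R : Type}
    [CommRing R] [Algebra ℚ R] {a b : R} (ha : a * a = 0) (hb : b * b = 0) :
    G.Mem (1 + (a * b) • (x * y - y * x).map (algebraMap ℚ R)) := by
  have hx' := hx.map (LinearMap.lsmul ℚ ℚ (-1))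
  have hy' := hy.map (LinearMap.lsmul ℚ ℚ (-1))
  have h := (((hx.mem_of_mul_self ha).mul (hy.mem_of_mul_self hb)).mul
    (hx'.mem_of_mul_self ha)).mul (hy'.mem_of_mul_self hb)
  convert h using 1
  have h1 : ∀ z : Mat W ℚ, (z.map (LinearMap.lsmul ℚ ℚ (-1))).map (algebraMap ℚ R) =
      - z.map (algebraMap ℚ R) := fun z => by ext i j; simp
  have h2 : (x * y - y * x).map (algebraMap ℚ R) = x.map (algebraMap ℚ R) * y.map (algebraMap ℚ R) -
      y.map (algebraMap ℚ R) * x.map (algebraMap ℚ R) := by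
    rw [← Matrix.map_mul, ← Matrix.map_mul, ← Matrix.map_sub _ (map_sub _)]
  rw [h1, h1, h2]
  generalize x.map (algebraMap ℚ R) = x
  generalize y.map (algebraMap ℚ R) = y
  have e1 : (a • x) * (a • x) = 0 := by rw [smul_mul_smul_comm, ha, zero_smul]
  have e2 : (b • y) * (b • y) = 0 := by rw [smul_mul_smul_comm, hb, zero_smul]
  have e3 : (a • x) * (b • y) * (a • x) = 0 := by
    rw [smul_mul_smul_comm, smul_mul_smul_comm, mul_right_comm, ha, zero_mul, zero_smul]
  have e4 : (b • y) * (a • x) * (b • y) = 0 := by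
    rw [smul_mul_smul_comm, smul_mul_smul_comm, mul_right_comm, hb, zero_mul, zero_smul]
  have e5 : (a * b) • (x * y - y * x) = (a • x) * (b • y) - (b • y) * (a • x) := by
    rw [smul_mul_smul_comm, smul_mul_smul_comm, mul_comm b a, smul_sub]
  rw [e5, smul_neg, smul_neg]
  generalize a • x = x at *
  generalize b • y = y at *
  have : (1 + x) * (1 + y) * (1 + -x) * (1 + -y) = 1 + (x * y - y * x) - x * x - y * y
    - x * y * x - y * x * -y + x * x * y + x * y * x * y - x * (y * y) := by noncomm_ring
  rw [this, mul_neg, e1, e2, e3, e4]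
  simp

/-- In `A[ε]` the elements `e` and `ε` have square zero, while `eε` is nonzero of square zero.
Sending `ε` to `eε` embeds `ℚ[ε]` into `A[ε]`, and the commutator point is the image of `1 + ε[x,
y]`. -/
theorem Tangent.bracket {x y : Mat W ℚ} (hx : G.Tangent x) (hy : G.Tangent y) {A : Type}
    [CommRing A] [Algebra ℚ A] {e : A} (he : e * e = 0) (hne : e ≠ 0) :
    G.Tangent (x * y - y * x) := by
  obtain ⟨a, ha'⟩ : ∃ a : DualNumber A, a = TrivSqZeroExt.inl e := ⟨_, rfl⟩
  obtain ⟨b, hb'⟩ : ∃ b : DualNumber A, b = DualNumber.eps := ⟨_, rfl⟩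
  have ha : a * a = 0 := by rw [ha', ← TrivSqZeroExt.inl_mul, he, TrivSqZeroExt.inl_zero]
  have hb : b * b = 0 := by rw [hb', DualNumber.eps_mul_eps]
  have hab : (a * b) * (a * b) = 0 := by rw [mul_mul_mul_comm, ha, zero_mul]
  let φ : DualNumber ℚ →ₐ[ℚ] DualNumber A :=
    DualNumber.lift ⟨(Algebra.ofId ℚ _, a * b), hab, fun r => mul_comm _ _⟩
  have hφe : φ DualNumber.eps = a * b := DualNumber.lift_apply_eps _
  have hφ : Function.Injective φ := by
    rw [injective_iff_map_eq_zero]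
    intro z hz
    have hz' : z = algebraMap ℚ _ z.fst + z.snd • DualNumber.eps := by
      ext <;> simp [TrivSqZeroExt.algebraMap_eq_inl]
    rw [hz', map_add, AlgHom.commutes, map_smul, hφe, ha', hb'] at hz
    have h1 := congrArg TrivSqZeroExt.fst hz
    have h2 := congrArg TrivSqZeroExt.snd hz
    have : Nontrivial A := ⟨e, 0, hne⟩
    simp [TrivSqZeroExt.algebraMap_eq_inl'] at h1 h2
    ext
    · exact h1
    · exact h2.resolve_right hne
  refine Mem.of_injective φ hφ (isUnit_one_add_inr _) ?_
  convert hx.commutator_mem hy ha hb using 1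
  ext i j : 1
  simp only [Matrix.add_apply, Matrix.smul_apply, Matrix.map_apply, map_add, smul_eq_mul]
  congr 1
  · rw [Matrix.one_apply, Matrix.one_apply]; split_ifs <;> simp
  · rw [DualNumber.inr_eq_smul_eps, map_smul, hφe, Algebra.smul_def, mul_comm]

theorem bracket_mem_lie {X Y : Module.End ℚ W} (hX : X ∈ G.lie) (hY : Y ∈ G.lie) :
    X * Y - Y * X ∈ G.lie := by
  rw [mem_lie_iff] at hX hY ⊢
  rw [map_sub, map_mul, map_mul]
  refine hX.bracket hY (A := DualNumber ℚ) (e := DualNumber.eps) DualNumber.eps_mul_eps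
    fun h => one_ne_zero (congrArg TrivSqZeroExt.snd h)

end AlgSubgroup

end QGroup

/-! ### From curves to tangent vectors, and from nilpotent tangent vectors to one-parameter groups.
-/

namespace QGroup

variable {W : Type*} [AddCommGroup W] [Module ℚ W] [Module.Finite ℚ W]

/-- The real functions that are differentiable at `0`. -/
def germs : Subalgebra ℚ (ℝ → ℝ) where
  carrier := {f | DifferentiableAt ℝ f 0}
  mul_mem' := fun hf hg => DifferentiableAt.mul hf hg
  add_mem' := fun hf hg => DifferentiableAt.add hf hg
  algebraMap_mem' := fun q =>
    differentiableAt_const (𝕜 := ℝ) (c := (algebraMap ℚ ℝ q)) (x := (0 : ℝ))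

/-- The expansion of first order at `0`. -/
def firstJet : germs →+* TrivSqZeroExt ℝ ℝ where
  toFun f := TrivSqZeroExt.inl (f.1 0) + TrivSqZeroExt.inr (deriv f.1 0)
  map_one' := by
    have : deriv (1 : ℝ → ℝ) 0 = 0 := deriv_const (0 : ℝ) (1 : ℝ)
    simp [this]
  map_zero' := by
    have : deriv (0 : ℝ → ℝ) 0 = 0 := deriv_const (0 : ℝ) (0 : ℝ)
    simp [this]
  map_add' f g := by
    ext
    · simp
    · simpa using deriv_add f.2 g.2
  map_mul' f g := by
    ext
    · simp
    · simpa [mul_comm, add_comm] using deriv_mul f.2 g.2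

/-- The right action of `ℚ` on `ℝ`. -/
@[reducible] def realOpModule : Module ℚᵐᵒᵖ ℝ :=
  Module.compHom ℝ (RingEquiv.toOpposite ℚ).symm.toRingHom

attribute [local instance] realOpModule

instance : IsCentralScalar ℚ ℝ := ⟨fun _ _ => rfl⟩

/-- Extension of scalars of the constant term. -/
def constExtend : TrivSqZeroExt ℚ ℝ →+* TrivSqZeroExt ℝ ℝ where
  toFun x := TrivSqZeroExt.inl (x.fst : ℝ) + TrivSqZeroExt.inr x.snd
  map_one' := by simp
  map_zero' := by simp
  map_add' x y := by ext <;> simp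
  map_mul' x y := by
    ext
    · simp
    · simp [Rat.smul_def]
      exact mul_comm _ _

theorem constExtend_injective : Function.Injective constExtend := by
  rw [injective_iff_map_eq_zero]
  intro x hx
  have h1 := congrArg TrivSqZeroExt.fst hx
  have h2 := congrArg TrivSqZeroExt.snd hx
  simp [constExtend] at h1 h2
  ext
  · simpa using h1
  · simpa using h2

theorem snd_aeval_add_eps {A : Type} [CommRing A] [Algebra ℚ A] (f : Polynomial ℚ) (a : A) :
    (Polynomial.aeval (algebraMap A (DualNumber A) a + DualNumber.eps) f).snd =
      Polynomial.aeval a (Polynomial.derivative f) := by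
  have h : (DualNumber.eps : DualNumber A) ^ 2 = 0 := by rw [sq, DualNumber.eps_mul_eps]
  have h1 := Polynomial.aeval_add_of_sq_eq_zero f (algebraMap A (DualNumber A) a) DualNumber.eps h
  rw [h1, Polynomial.aeval_algebraMap_apply, Polynomial.aeval_algebraMap_apply]
  simp [TrivSqZeroExt.algebraMap_eq_inl]

namespace AlgSubgroup

variable {G : AlgSubgroup W}

/-- The curve is a single matrix over the ring `germs`, and the equations of `G` vanish on it
identically in `θ`. Passing to the first jet at `0`, a ring homomorphism, leaves `1 + εY`. -/
theorem tangent_of_circle {Y : Mat W ℝ}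
    (h : ∀ θ : ℝ, G.Mem (Real.cos θ • 1 + Real.sin θ • Y)) : G.Tangent Y := by
  let u : Mat W germs := Matrix.of fun i j =>
    ⟨fun θ => Real.cos θ * (1 : Mat W ℝ) i j + Real.sin θ * Y i j, by
      change DifferentiableAt ℝ _ 0
      fun_prop⟩
  -- The jet has coefficients in `ℝ ⊕ ℝε`, whereas `Tangent` asks for `ℚ ⊕ ℝε`; the two are compared
  -- inside the larger ring.
  refine Mem.of_injective constExtend.toRatAlgHom constExtend_injective (isUnit_one_add_inr _) ?_
  have hu : (1 + Y.map (TrivSqZeroExt.inr : ℝ → TrivSqZeroExt ℚ ℝ)).map constExtend.toRatAlgHom =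
      u.map firstJet.toRatAlgHom := by
    ext i j : 1
    ext
    · by_cases hij : i = j <;> simp [constExtend, firstJet, u, Matrix.one_apply, hij]
    · by_cases hij : i = j
      · subst hij
        simp [constExtend, firstJet, u]
      · simp [constExtend, firstJet, u, hij]
  refine mem_iff.2 ⟨(isUnit_one_add_inr Y).map constExtend.toRatAlgHom.mapMatrix, fun p hp => ?_⟩
  rw [hu, entries_map, ← MvPolynomial.comp_aeval_apply]
  have : MvPolynomial.aeval (entries u) p = 0 := by
    apply Subtype.ext
    funext θ
    have h1 := (mem_iff.1 (h θ)).2 p hp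
    have h2 : entries (Real.cos θ • 1 + Real.sin θ • Y) = fun ij =>
      ((Pi.evalAlgHom ℚ (fun _ : ℝ => ℝ) θ).comp germs.val) (entries u ij) := by
      funext ij
      simp [entries, u]
    rw [h2, ← MvPolynomial.comp_aeval_apply] at h1
    exact h1
  rw [this, map_zero]

/-- If the first order deformation `1 + εX` is in `G` and `X² = 0`, the whole one-parameter group
is in `G`. -/
theorem Tangent.mem_of_sq_eq_zero {X : Mat W ℚ} (hX : G.Tangent X) (hXX : X * X = 0) {R : Type}
    [CommRing R] [Algebra ℚ R] (r : R) : G.Mem (1 + r • X.map (algebraMap ℚ R)) := by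
  classical
  have hsq : ∀ (A : Type) [CommRing A] [Algebra ℚ A],
      X.map (algebraMap ℚ A) * X.map (algebraMap ℚ A) = 0 := by
    intro A _ _
    rw [← Matrix.map_mul, hXX]
    ext i j
    simp
  have hunit : ∀ (A : Type) [CommRing A] [Algebra ℚ A] (a : A),
      IsUnit (1 + a • X.map (algebraMap ℚ A)) := by
    intro A _ _ a
    have h0 : (a • X.map (algebraMap ℚ A)) * (a • X.map (algebraMap ℚ A)) = 0 := by
      rw [smul_mul_smul_comm, hsq, smul_zero]
    exact ⟨⟨1 + a • X.map (algebraMap ℚ A), 1 - a • X.map (algebraMap ℚ A),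
      by rw [mul_sub, mul_one, add_mul, h0]; simp,
      by rw [sub_mul, one_mul, mul_add, h0]; simp⟩, rfl⟩
  let U : Mat W (Polynomial ℚ) := 1 + (Polynomial.X : Polynomial ℚ) • X.map (algebraMap ℚ _)
  have hU : ∀ {A : Type} [CommRing A] [Algebra ℚ A] (a : A),
      U.map (Polynomial.aeval a) = 1 + a • X.map (algebraMap ℚ A) := by
    intro A _ _ a
    ext i j
    simp [U, Matrix.one_apply, apply_ite (Polynomial.aeval a)]
    exact mul_comm _ _
  let P : MvPolynomial (Fin (Module.finrank ℚ W) × Fin (Module.finrank ℚ W)) ℚ → Polynomial ℚ :=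
    fun p => MvPolynomial.aeval (entries U) p
  have hP : ∀ {A : Type} [CommRing A] [Algebra ℚ A] (a : A)
      (p : MvPolynomial (Fin (Module.finrank ℚ W) × Fin (Module.finrank ℚ W)) ℚ),
      MvPolynomial.aeval (entries (1 + a • X.map (algebraMap ℚ A))) p =
        Polynomial.aeval a (P p) := by
    intro A _ _ a p
    rw [← hU, entries_map, ← MvPolynomial.comp_aeval_apply]
  have hmem : ∀ {A : Type} [CommRing A] [Algebra ℚ A] (a : A),
      G.Mem (1 + a • X.map (algebraMap ℚ A)) ↔ ∀ p ∈ G.eqs, Polynomial.aeval a (P p) = 0 := by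
    intro A _ _ a
    rw [mem_iff]
    simp only [hP, hunit, true_and]
  have hadd : ∀ {A : Type} [CommRing A] [Algebra ℚ A] (a b : A),
      G.Mem (1 + a • X.map (algebraMap ℚ A)) → G.Mem (1 + b • X.map (algebraMap ℚ A)) →
      G.Mem (1 + (a + b) • X.map (algebraMap ℚ A)) := by
    intro A _ _ a b ha hb
    have h := ha.mul hb
    rwa [mul_add, mul_one, add_mul, one_mul, smul_mul_smul_comm, hsq, smul_zero, add_zero,
      add_assoc, ← add_smul] at h
  -- `I` is the ideal of the closed set of parameters `r` with `1 + rX` in `G`. It is shown to be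
  -- zero.
  let I : Ideal (Polynomial ℚ) := Ideal.span (P '' G.eqs)
  -- Translating the universal parameter in `ℚ[X]/I` by the admissible parameter `ε` stays inside
  -- `G`; the `ε`-coefficient of `f(X + ε)` is the derivative.
  have hder : ∀ f ∈ I, Polynomial.derivative f ∈ I := by
    have hmk : ∀ f : Polynomial ℚ, Polynomial.aeval (Ideal.Quotient.mk I Polynomial.X) f =
        Ideal.Quotient.mk I f := fun f => by
      rw [← Ideal.Quotient.mkₐ_eq_mk ℚ, Polynomial.aeval_algHom_apply,
        Polynomial.aeval_X_left_apply]
    have h1 : G.Mem (1 + (Ideal.Quotient.mk I Polynomial.X) •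
        X.map (algebraMap ℚ (Polynomial ℚ ⧸ I))) := by
      rw [hmem]
      intro p hp
      rw [hmk, Ideal.Quotient.eq_zero_iff_mem]
      exact Ideal.subset_span ⟨p, hp, rfl⟩
    have h0 : G.Mem (1 + algebraMap (Polynomial ℚ ⧸ I) (DualNumber (Polynomial ℚ ⧸ I))
        (Ideal.Quotient.mk I Polynomial.X) •
          X.map (algebraMap ℚ (DualNumber (Polynomial ℚ ⧸ I)))) := by
      rw [hmem]
      intro p hp
      rw [Polynomial.aeval_algebraMap_apply, (hmem _).1 h1 p hp, map_zero]
    have h2 := (hmem _).1 (hadd _ _ h0 (hX.mem_of_mul_self (R := DualNumber (Polynomial ℚ ⧸ I))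
      DualNumber.eps_mul_eps))
    have h3 : ∀ p ∈ G.eqs, Polynomial.derivative (P p) ∈ I := by
      intro p hp
      have h5 := congrArg TrivSqZeroExt.snd (h2 p hp)
      rw [← Ideal.Quotient.eq_zero_iff_mem, ← hmk, ← snd_aeval_add_eps]
      exact h5
    intro f hf
    induction hf using Submodule.span_induction with
    | mem f hf =>
      obtain ⟨p, hp, rfl⟩ := hf
      exact h3 p hp
    | zero => simp
    | add f g _ _ hf hg => rw [map_add]; exact add_mem hf hg
    | smul a f hfI hf =>
      rw [smul_eq_mul, Polynomial.derivative_mul]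
      exact add_mem (I.mul_mem_left _ hfI) (I.mul_mem_left _ hf)
  -- The generator divides its own derivative, so it is constant by degree; it vanishes at the
  -- parameter `0` of the identity, so it is zero.
  obtain ⟨Q, hQ⟩ : ∃ Q, I = Ideal.span {Q} := IsPrincipalIdealRing.principal I |>.principal
  have hQ' : Q ∣ Polynomial.derivative Q := by
    rw [← Ideal.mem_span_singleton, ← hQ]
    exact hder Q (hQ ▸ Ideal.mem_span_singleton_self Q)
  have hQ0 : Polynomial.eval 0 Q = 0 := by
    have h0 : G.Mem (1 + (0 : ℚ) • X.map (algebraMap ℚ ℚ)) := by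
      rw [zero_smul, add_zero]; exact Mem.one
    have h1 : I ≤ RingHom.ker (Polynomial.aeval (0 : ℚ) : Polynomial ℚ →ₐ[ℚ] ℚ) := by
      rw [Ideal.span_le]
      rintro _ ⟨p, hp, rfl⟩
      exact (hmem 0).1 h0 p hp
    exact h1 (hQ ▸ Ideal.mem_span_singleton_self Q)
  have hQz : Q = 0 := by
    have h1 : Polynomial.derivative Q = 0 := by
      by_contra hne
      have h2 := Polynomial.degree_le_of_dvd hQ' hne
      exact absurd (Polynomial.degree_derivative_lt (fun h => hne (by rw [h, map_zero])))
        (not_lt.2 h2)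
    have h2 := Polynomial.derivative_eq_zero.1 h1
    rw [Polynomial.eq_C_of_natDegree_eq_zero h2] at hQ0 ⊢
    rw [Polynomial.eval_C] at hQ0
    rw [hQ0, map_zero]
  rw [hmem]
  intro p hp
  have : P p ∈ I := Ideal.subset_span ⟨p, hp, rfl⟩
  rw [hQ, hQz, Ideal.span_singleton_eq_bot.2 rfl, Ideal.mem_bot] at this
  rw [this, map_zero]

end AlgSubgroup

end QGroup

/-! ### Stabilizers of forms, and the Weil restriction of `SL` as one of them. -/

namespace QGroup

section FormStabilizer

variable {W : Type*} [AddCommGroup W] [Module ℚ W] [Module.Finite ℚ W]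

/-- `u` preserves the `R`-bilinear extension of `B`. -/
def Preserves (R : Type) [CommRing R] [Algebra ℚ R] (B : LinearMap.BilinForm ℚ W)
    (u : Module.End R (R ⊗[ℚ] W)) : Prop :=
  ∀ x y, LinearMap.BilinForm.baseChange R B (u x) (u y) = LinearMap.BilinForm.baseChange R B x y

theorem toMatrix_baseChange_bilin (R : Type) [CommRing R] [Algebra ℚ R]
    (B : LinearMap.BilinForm ℚ W) :
    LinearMap.BilinForm.toMatrix ((Module.finBasis ℚ W).baseChange R)
      (LinearMap.BilinForm.baseChange R B) =
    (LinearMap.BilinForm.toMatrix (Module.finBasis ℚ W) B).map (algebraMap ℚ R) := by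
  ext i j
  simp [LinearMap.BilinForm.toMatrix_apply, Module.Basis.baseChange_apply, Algebra.smul_def]

theorem preserves_iff (R : Type) [CommRing R] [Algebra ℚ R] (B : LinearMap.BilinForm ℚ W)
    (u : Module.End R (R ⊗[ℚ] W)) :
    Preserves R B u ↔
      (toMat R u).transpose *
        (LinearMap.BilinForm.toMatrix (Module.finBasis ℚ W) B).map (algebraMap ℚ R) *
        toMat R u = (LinearMap.BilinForm.toMatrix (Module.finBasis ℚ W) B).map (algebraMap ℚ R) := by
  rw [← toMatrix_baseChange_bilin]
  change _ ↔ (LinearMap.toMatrix _ _ u).transpose * _ * LinearMap.toMatrix _ _ u = _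
  rw [← LinearMap.BilinForm.toMatrix_comp,
    (LinearMap.BilinForm.toMatrix ((Module.finBasis ℚ W).baseChange R)).injective.eq_iff]
  constructor
  · intro h
    exact LinearMap.ext fun x => LinearMap.ext fun y => h x y
  · intro h x y
    exact LinearMap.congr_fun (LinearMap.congr_fun h x) y

/-- The subgroup of `GL(W)` that preserves a set of bilinear forms. -/
def formStabilizer (𝔅 : Set (LinearMap.BilinForm ℚ W)) : AlgSubgroup W where
  pts R _ _ :=
    { carrier := {u | ∀ B ∈ 𝔅, Preserves R B (u : Module.End R (R ⊗[ℚ] W))}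
      one_mem' := fun B _ x y => rfl
      mul_mem' := fun {a b} ha hb B hB x y => (ha B hB _ _).trans (hb B hB x y)
      inv_mem' := fun {a} ha B hB x y => by
        have h1 : ∀ x, (a : Module.End R (R ⊗[ℚ] W))
            ((a⁻¹ : LinearMap.GeneralLinearGroup R (R ⊗[ℚ] W)).1 x) = x :=
          fun x => LinearMap.congr_fun (Units.mul_inv a) x
        rw [← ha B hB, h1, h1] }
  isClosed := by
    let n := Fin (Module.finrank ℚ W)
    let X : Matrix n n (MvPolynomial (n × n) ℚ) := Matrix.of fun i j => MvPolynomial.X (i, j)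
    let Q := fun B : LinearMap.BilinForm ℚ W =>
      X.transpose * (LinearMap.BilinForm.toMatrix (Module.finBasis ℚ W) B).map (algebraMap ℚ _) * X -
        (LinearMap.BilinForm.toMatrix (Module.finBasis ℚ W) B).map (algebraMap ℚ _)
    refine ⟨{p | ∃ B ∈ 𝔅, ∃ i j, p = Q B i j}, fun R _ _ u => ?_⟩
    have hX : X.map (MvPolynomial.aeval (entry R u)) = toMat R (u : Module.End R (R ⊗[ℚ] W)) := by
      ext i j
      simp [X, entry_eq, entries]
    have hQ : ∀ B, (Q B).map (MvPolynomial.aeval (entry R u)) = (toMat R u.1).transpose *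
        (LinearMap.BilinForm.toMatrix (Module.finBasis ℚ W) B).map (algebraMap ℚ R) *
        toMat R u.1 - (LinearMap.BilinForm.toMatrix (Module.finBasis ℚ W) B).map (algebraMap ℚ R) := by
      intro B
      have hc : ∀ M : Matrix n n ℚ, (M.map (algebraMap ℚ (MvPolynomial (n × n) ℚ))).map
          (MvPolynomial.aeval (entry R u)) = M.map (algebraMap ℚ R) := fun M => by
        ext i j
        simp
      rw [Matrix.map_sub _ (map_sub _), Matrix.map_mul, Matrix.map_mul, Matrix.transpose_map, hX,
        hc]
    have h1 : ∀ B, Preserves R B (u : Module.End R (R ⊗[ℚ] W)) ↔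
        ∀ i j, MvPolynomial.aeval (entry R u) (Q B i j) = 0 := by
      intro B
      rw [preserves_iff, ← sub_eq_zero, ← hQ]
      exact ⟨fun h i j => congrFun (congrFun h i) j, fun h => by ext i j; exact h i j⟩
    constructor
    · rintro h _ ⟨B, hB, i, j, rfl⟩
      exact (h1 B).1 (h B hB) i j
    · intro h B hB
      exact (h1 B).2 fun i j => h _ ⟨B, hB, i, j, rfl⟩

theorem of_mem_lie_formStabilizer {𝔅 : Set (LinearMap.BilinForm ℚ W)} {X : Module.End ℚ W}
    (hX : X ∈ (formStabilizer 𝔅).lie) {B : LinearMap.BilinForm ℚ W} (hB : B ∈ 𝔅) (x y : W) :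
    B (X x) y + B x (X y) = 0 := by
  obtain ⟨u, hu, h⟩ := hX
  have h1 := hu B hB (1 ⊗ₜ x) (1 ⊗ₜ y)
  rw [h] at h1
  have h2 := congrArg TrivSqZeroExt.snd h1
  simp only [LinearMap.add_apply, Module.End.one_apply, LinearMap.smul_apply,
    LinearMap.baseChange_tmul, map_add, map_smul, LinearMap.BilinForm.baseChange_tmul] at h2
  simpa [add_comm] using h2

end FormStabilizer

section Weil

variable {E W : Type*} [Field E] [Algebra ℚ E] [AddCommGroup W] [Module ℚ W] [Module E W]
  [IsScalarTower ℚ E W] (b : Module.Basis (Fin 2) E W)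

/-- The coordinates of an `E`-plane as `ℚ`-linear maps. -/
def coordQ (i : Fin 2) : W →ₗ[ℚ] E := (b.coord i).restrictScalars ℚ

/-- The coordinates of `R ⊗ W` over `R ⊗ E`. -/
def coordR (R : Type) [CommRing R] [Algebra ℚ R] (i : Fin 2) : R ⊗[ℚ] W →ₗ[R] R ⊗[ℚ] E :=
  (coordQ b i).baseChange R

variable {R : Type} [CommRing R] [Algebra ℚ R]

theorem tensorAction_tmul (r s : R) (e : E) (w : W) :
    tensorAction E W R (r ⊗ₜ e) (s ⊗ₜ w) = (r * s) ⊗ₜ (e • w) := by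
  have h : tensorAction E W R (r ⊗ₜ e) = Algebra.ofId R (Module.End R (R ⊗[ℚ] W)) r *
      (Algebra.lsmul ℚ ℚ W e : Module.End ℚ W).baseChange R :=
    Algebra.TensorProduct.lift_tmul _ _ _ r e
  rw [h]
  simp [Algebra.ofId_apply, Module.algebraMap_end_apply, TensorProduct.smul_tmul']

theorem coordR_tmul (i : Fin 2) (r : R) (w : W) :
    coordR b R i (r ⊗ₜ w) = r ⊗ₜ (b.repr w i) := by
  simp [coordR, coordQ]

theorem coordR_tensorAction (i : Fin 2) (ρ : R ⊗[ℚ] E) (x : R ⊗[ℚ] W) :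
    coordR b R i (tensorAction E W R ρ x) = ρ * coordR b R i x := by
  induction ρ using TensorProduct.induction_on with
  | zero => simp
  | add ρ σ h1 h2 => rw [map_add, LinearMap.add_apply, map_add, h1, h2, add_mul]
  | tmul r e =>
    induction x using TensorProduct.induction_on with
    | zero => simp
    | add x y h1 h2 => rw [map_add, map_add, h1, h2, map_add, mul_add]
    | tmul s w => simp [tensorAction_tmul, coordR_tmul]

theorem sum_tensorAction_coordR (x : R ⊗[ℚ] W) :
    tensorAction E W R (coordR b R 0 x) (1 ⊗ₜ b 0) +
      tensorAction E W R (coordR b R 1 x) (1 ⊗ₜ b 1) = x := by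
  induction x using TensorProduct.induction_on with
  | zero => simp
  | add x y h1 h2 =>
    nth_rewrite 3 [← h1]
    nth_rewrite 3 [← h2]
    simp only [map_add, LinearMap.add_apply]
    abel
  | tmul s w =>
    rw [coordR_tmul, coordR_tmul, tensorAction_tmul, tensorAction_tmul, mul_one,
      ← TensorProduct.tmul_add, ← Fin.sum_univ_two (fun i => b.repr w i • b i), b.sum_repr]

theorem coordR_ext {x y : R ⊗[ℚ] W} (h0 : coordR b R 0 x = coordR b R 0 y)
    (h1 : coordR b R 1 x = coordR b R 1 y) : x = y := by
  rw [← sum_tensorAction_coordR b x, h0, h1, sum_tensorAction_coordR]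

theorem coordR_basis (i j : Fin 2) :
    coordR b R i ((1 : R) ⊗ₜ b j) = if i = j then 1 else 0 := by
  rw [coordR_tmul, Module.Basis.repr_self, Finsupp.single_apply]
  by_cases h : j = i
  · subst h; simp [Algebra.TensorProduct.one_def]
  · have h' : ¬ i = j := fun e => h e.symm
    simp [h, h']

/-- The basis of `R ⊗ W` over `R ⊗ E` given by a basis of `W` over `E`. -/
def basisR (R : Type) [CommRing R] [Algebra ℚ R] :
    letI := tensorModule E W R
    Module.Basis (Fin 2) (R ⊗[ℚ] E) (R ⊗[ℚ] W) :=
  letI := tensorModule E W R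
  Module.Basis.ofEquivFun
    { toFun := fun x i => coordR b R i x
      map_add' := fun x y => by ext i; simp
      map_smul' := fun ρ x => funext fun i => coordR_tensorAction b i ρ x
      invFun := fun c => tensorAction E W R (c 0) (1 ⊗ₜ b 0) + tensorAction E W R (c 1) (1 ⊗ₜ b 1)
      left_inv := fun x => sum_tensorAction_coordR b x
      right_inv := fun c => by
        ext i
        fin_cases i <;> simp [coordR_tensorAction, coordR_basis] }

/-- The `R`-bilinear extension of the determinant in the basis `b`. -/
def detForm (x y : R ⊗[ℚ] W) : R ⊗[ℚ] E :=
  coordR b R 0 x * coordR b R 1 y - coordR b R 1 x * coordR b R 0 y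

/-- A `ℚ`-valued component of the determinant in the basis `b`. -/
def detComponent (l : E →ₗ[ℚ] ℚ) : LinearMap.BilinForm ℚ W :=
  LinearMap.mk₂ ℚ (fun x y => l (coordQ b 0 x * coordQ b 1 y - coordQ b 1 x * coordQ b 0 y))
    (fun x y z => by rw [← map_add]; congr 1; simp only [map_add]; ring)
    (fun c x y => by
      rw [← map_smul]; congr 1; simp only [map_smul, Algebra.smul_def]; ring)
    (fun x y z => by rw [← map_add]; congr 1; simp only [map_add]; ring)
    (fun c x y => by
      rw [← map_smul]; congr 1; simp only [map_smul, Algebra.smul_def]; ring)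

theorem detComponent_apply (l : E →ₗ[ℚ] ℚ) (x y : W) : detComponent b l x y =
    l (b.repr x 0 * b.repr y 1 - b.repr x 1 * b.repr y 0) := rfl

theorem baseChange_detComponent (l : E →ₗ[ℚ] ℚ) (x y : R ⊗[ℚ] W) :
    LinearMap.BilinForm.baseChange R (detComponent b l) x y =
      TensorProduct.rid ℚ R (l.baseChange R (detForm b x y)) := by
  induction x using TensorProduct.induction_on with
  | zero => simp [detForm]
  | add x z h1 h2 =>
    rw [map_add, LinearMap.add_apply, h1, h2, ← map_add, ← map_add]
    congr 2
    simp only [detForm, map_add]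
    ring
  | tmul s w =>
    induction y using TensorProduct.induction_on with
    | zero => simp [detForm]
    | add x z h1 h2 =>
      rw [map_add, h1, h2, ← map_add, ← map_add]
      congr 2
      simp only [detForm, map_add]
      ring
    | tmul t v =>
      simp [detForm, coordR_tmul, detComponent_apply, ← TensorProduct.tmul_sub]

theorem eq_of_baseChange_eq [Module.Finite ℚ E] {x y : R ⊗[ℚ] E}
    (h : ∀ l : E →ₗ[ℚ] ℚ, TensorProduct.rid ℚ R (l.baseChange R x) =
      TensorProduct.rid ℚ R (l.baseChange R y)) : x = y := by
  let c := Module.finBasis ℚ E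
  have key : ∀ (z : R ⊗[ℚ] E) (i), (c.baseChange R).repr z i =
      TensorProduct.rid ℚ R ((c.coord i).baseChange R z) := by
    intro z i
    induction z using TensorProduct.induction_on with
    | zero => simp
    | add x y h1 h2 => simp only [map_add, Finsupp.add_apply, h1, h2]
    | tmul r e => simp
  apply (c.baseChange R).repr.injective
  ext i
  rw [key, key, h]

/-- A linear `v` multiplies the determinant form by `det v`. Conversely, preservation of the form
already forces linearity over `R ⊗ E`: compare `u(ρx)` with `ρ u(x)` against the surjective image of
`u`, the form being nondegenerate. -/
theorem mem_resSL_iff (u : LinearMap.GeneralLinearGroup R (R ⊗[ℚ] W)) :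
    u ∈ resSL E W R ↔ ∀ x y, detForm b (u.1 x) (u.1 y) = detForm b x y := by
  let _ := tensorModule E W R
  have hdet : ∀ v : (R ⊗[ℚ] W) →ₗ[R ⊗[ℚ] E] (R ⊗[ℚ] W), ∀ x y, detForm b (v x) (v y) =
      LinearMap.det v * detForm b x y := by
    intro v x y
    have h1 : ∀ x i, coordR b R i (v x) =
        LinearMap.toMatrix (basisR b R) (basisR b R) v i 0 * coordR b R 0 x +
        LinearMap.toMatrix (basisR b R) (basisR b R) v i 1 * coordR b R 1 x := by
      intro x i
      have := congrFun (LinearMap.toMatrix_mulVec_repr (basisR b R) (basisR b R) v x) i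
      rw [Matrix.mulVec, dotProduct, Fin.sum_univ_two] at this
      exact this.symm
    rw [← LinearMap.det_toMatrix (basisR b R), Matrix.det_fin_two]
    simp only [detForm, h1]
    ring
  have hbasis : detForm b ((1 : R) ⊗ₜ b 0) ((1 : R) ⊗ₜ b 1) = 1 := by
    simp [detForm, coordR_basis]
  constructor
  · rintro ⟨v, hv, hv1⟩ x y
    have := hdet v x y
    rw [hv1, one_mul] at this
    rw [← this]
    simp only [hv]
  · intro h
    have hsurj : ∀ y, ∃ z, u.1 z = y := fun y =>
      ⟨(u⁻¹).1 y, LinearMap.congr_fun (Units.mul_inv u) y⟩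
    have hlin : ∀ (ρ : R ⊗[ℚ] E) x, u.1 (tensorAction E W R ρ x) =
        tensorAction E W R ρ (u.1 x) := by
      intro ρ x
      have h1 : ∀ y, detForm b (u.1 (tensorAction E W R ρ x)) y =
          detForm b (tensorAction E W R ρ (u.1 x)) y := by
        intro y
        obtain ⟨z, rfl⟩ := hsurj y
        rw [h]
        have h2 : ∀ x z : R ⊗[ℚ] W, detForm b (tensorAction E W R ρ x) z = ρ * detForm b x z := by
          intro x z
          simp only [detForm, coordR_tensorAction]
          ring
        rw [h2, h2, h]
      have h3 := h1 (1 ⊗ₜ b 0)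
      have h4 := h1 (1 ⊗ₜ b 1)
      simp [detForm, coordR_basis] at h3 h4
      exact coordR_ext b h4 h3
    let v : (R ⊗[ℚ] W) →ₗ[R ⊗[ℚ] E] (R ⊗[ℚ] W) :=
      { toFun := u.1
        map_add' := map_add u.1
        map_smul' := hlin }
    refine ⟨v, fun x => rfl, ?_⟩
    have h5 := hdet v (1 ⊗ₜ b 0) (1 ⊗ₜ b 1)
    rw [hbasis, mul_one] at h5
    rw [← h5, ← hbasis]
    exact h _ _

variable [Module.Finite ℚ E] [Module.Finite ℚ W]

/-- The determinant takes values in `R ⊗ E`; linear functionals on `E` separate these, which turns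
the condition into invariance of rational bilinear forms. So the Weil restriction is an algebraic
subgroup over `ℚ`. -/
theorem resSL_eq : resSL E W R =
    (formStabilizer (Set.range (detComponent b : (E →ₗ[ℚ] ℚ) → _))).pts R := by
  ext u
  rw [mem_resSL_iff b]
  constructor
  · rintro h _ ⟨l, rfl⟩ x y
    rw [baseChange_detComponent, baseChange_detComponent, h]
  · intro h x y
    refine eq_of_baseChange_eq fun l => ?_
    rw [← baseChange_detComponent, ← baseChange_detComponent]
    exact h _ ⟨l, rfl⟩ x y

theorem eq_of_dual_eq {x y : E} (h : ∀ l : E →ₗ[ℚ] ℚ, l x = l y) : x = y := by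
  apply (Module.finBasis ℚ E).repr.injective
  ext i
  exact h ((Module.finBasis ℚ E).coord i)

/-- Infinitesimal invariance says `det(Xx, y) + det(x, Xy) = 0`. Nondegeneracy forces `X` to be
`E`-linear, and evaluation on the basis gives trace zero. -/
theorem lie_le_slOver {X : Module.End ℚ W}
    (hX : X ∈ (formStabilizer (Set.range (detComponent b : (E →ₗ[ℚ] ℚ) → _))).lie) :
    X ∈ slOver ℚ E W := by
  have h : ∀ x y : W, b.repr (X x) 0 * b.repr y 1 - b.repr (X x) 1 * b.repr y 0 +
      (b.repr x 0 * b.repr (X y) 1 - b.repr x 1 * b.repr (X y) 0) = 0 := by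
    intro x y
    refine eq_of_dual_eq fun l => ?_
    rw [map_add, map_zero l, ← detComponent_apply, ← detComponent_apply]
    exact of_mem_lie_formStabilizer hX ⟨l, rfl⟩ x y
  have hlin : ∀ (e : E) x, X (e • x) = e • X x := by
    intro e x
    apply b.ext_elem
    have h3 : ∀ y : W, b.repr (X (e • x)) 0 * b.repr y 1 - b.repr (X (e • x)) 1 * b.repr y 0 =
        e * (b.repr (X x) 0 * b.repr y 1 - b.repr (X x) 1 * b.repr y 0) := by
      intro y
      have h1 := h (e • x) y
      simp only [map_smul, Finsupp.smul_apply, smul_eq_mul] at h1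
      linear_combination h1 - e * h x y
    have h4 := h3 (b 0)
    have h5 := h3 (b 1)
    simp at h4 h5
    intro i
    fin_cases i
    · simpa using h5
    · simpa using h4
  refine ⟨{ X with map_smul' := hlin }, rfl, ?_⟩
  rw [LinearMap.trace_eq_matrix_trace E b, Matrix.trace_fin_two, LinearMap.toMatrix_apply,
    LinearMap.toMatrix_apply]
  have h6 := h (b 0) (b 1)
  simpa using h6

end Weil

end QGroup

/-! ### Elementary generation of `SL₂` and passage from the Lie algebra to the group. -/

namespace QGroup

/-- If no `t` worked, two different rational `t` would share one of the finitely many maximal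
ideals. That ideal would contain `d` and `c`, hence `ad - bc = 1`. -/
theorem exists_isUnit_add_smul {S : Type*} [CommRing S] [Algebra ℚ S]
    (hfin : Finite (MaximalSpectrum S)) {a b c d : S} (h : a * d - b * c = 1) :
    ∃ t : ℚ, IsUnit (c + t • d) := by
  by_contra! hcon
  have h1 : ∀ t : ℚ, ∃ M : MaximalSpectrum S, c + t • d ∈ M.asIdeal := fun t => by
    obtain ⟨M, hM, hm⟩ := exists_max_ideal_of_mem_nonunits (hcon t)
    exact ⟨⟨M, hM⟩, hm⟩
  choose f hf using h1
  obtain ⟨t, s, hts, hfs⟩ := Finite.exists_ne_map_eq_of_infinite f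
  have h2 : (t - s) • d ∈ (f t).asIdeal := by
    have := (f t).asIdeal.sub_mem (hf t) (hfs ▸ hf s)
    rwa [add_sub_add_left_eq_sub, ← sub_smul] at this
  have hd : d ∈ (f t).asIdeal := by
    have h3 : d = algebraMap ℚ S (t - s)⁻¹ * ((t - s) • d) := by
      rw [← Algebra.smul_def, smul_smul, inv_mul_cancel₀ (sub_ne_zero.2 hts), one_smul]
    rw [h3]
    exact Ideal.mul_mem_left _ _ h2
  have hc : c ∈ (f t).asIdeal := by
    have h4 : t • d ∈ (f t).asIdeal := by
      rw [Algebra.smul_def]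
      exact Ideal.mul_mem_left _ _ hd
    have := (f t).asIdeal.sub_mem (hf t) h4
    rwa [add_sub_cancel_right] at this
  refine (f t).isMaximal.ne_top ((Ideal.eq_top_iff_one _).2 ?_)
  rw [← h]
  exact sub_mem (Ideal.mul_mem_left _ _ hd) (Ideal.mul_mem_left _ _ hc)

theorem finite_maximalSpectrum_of_finite (R S : Type*) [CommRing R] [IsLocalRing R] [CommRing S]
    [Algebra R S] [Module.Finite R S] : Finite (MaximalSpectrum S) := by
  have hfin := Algebra.QuasiFinite.finite_primesOver (R := R) (S := S) (IsLocalRing.maximalIdeal R)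
  have : Finite ((IsLocalRing.maximalIdeal R).primesOver S) := hfin
  refine Finite.of_injective (fun M : MaximalSpectrum S =>
    (⟨M.asIdeal, M.isMaximal.isPrime, ⟨?_⟩⟩ : (IsLocalRing.maximalIdeal R).primesOver S)) ?_
  · have := M.isMaximal
    exact (IsLocalRing.eq_maximalIdeal (Ideal.isMaximal_comap_of_isIntegral_of_isMaximal
      (R := R) M.asIdeal)).symm
  · intro M N h
    exact MaximalSpectrum.ext (congrArg Subtype.val h)

variable {E W : Type*} [Field E] [Algebra ℚ E] [AddCommGroup W] [Module ℚ W] [Module E W]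
  [IsScalarTower ℚ E W] [Module.Finite ℚ E] [Module.Finite ℚ W] (b : Module.Basis (Fin 2) E W)

/-- The nilpotent operator that sends the `j`-th basis vector to the `i`-th one. -/
def nilp (i j : Fin 2) : Module.End E W := (b.coord j).smulRight (b i)

theorem nilp_apply (i j : Fin 2) (w : W) : nilp b i j w = b.repr w j • b i := rfl

/-- The elementary operator with parameter `ρ ∈ R ⊗ E`. -/
def elementary {R : Type} [CommRing R] [Algebra ℚ R] (i j : Fin 2) (ρ : R ⊗[ℚ] E) :
    Module.End R (R ⊗[ℚ] W) :=
  1 + tensorAction E W R ρ * ((nilp b i j).restrictScalars ℚ).baseChange R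

variable {R : Type} [CommRing R] [Algebra ℚ R]

theorem coordR_nilp (i j k : Fin 2) (x : R ⊗[ℚ] W) :
    coordR b R k (((nilp b i j).restrictScalars ℚ).baseChange R x) =
      if k = i then coordR b R j x else 0 := by
  induction x using TensorProduct.induction_on with
  | zero => simp
  | add x y h1 h2 => simp only [map_add, h1, h2]; split_ifs <;> simp
  | tmul r w =>
    rw [LinearMap.baseChange_tmul, coordR_tmul, coordR_tmul, LinearMap.restrictScalars_apply,
      nilp_apply, map_smul, Module.Basis.repr_self, Finsupp.smul_apply, Finsupp.single_apply]
    by_cases h : i = k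
    · simp [h]
    · have h' : ¬ k = i := fun e => h e.symm
      simp [h, h']

theorem coordR_elementary (i j k : Fin 2) (ρ : R ⊗[ℚ] E) (x : R ⊗[ℚ] W) :
    coordR b R k (elementary b i j ρ x) =
      coordR b R k x + if k = i then ρ * coordR b R j x else 0 := by
  rw [elementary, LinearMap.add_apply, map_add, Module.End.one_apply, Module.End.mul_apply,
    coordR_tensorAction, coordR_nilp]
  split_ifs <;> simp

theorem elementary_add {i j : Fin 2} (hij : i ≠ j) (ρ σ : R ⊗[ℚ] E) :
    elementary b i j (ρ + σ) = elementary b i j ρ * elementary b i j σ := by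
  refine LinearMap.ext fun x => ?_
  have : ∀ k, coordR b R k (elementary b i j (ρ + σ) x) =
      coordR b R k ((elementary b i j ρ * elementary b i j σ) x) := by
    intro k
    simp only [Module.End.mul_apply, coordR_elementary]
    rw [if_neg hij.symm]
    split_ifs <;> ring
  exact coordR_ext b (this 0) (this 1)

variable {b} {G : AlgSubgroup W}

/-- Additivity in `ρ` reduces to `ρ = r ⊗ e`, where the operator is `1 + rX` with `X = e · nilp` in
`sl(W/E)` of square zero. -/
theorem elementary_mem (hG : ∀ X ∈ slOver ℚ E W, X ∈ G.lie) {i j : Fin 2} (hij : i ≠ j)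
    (ρ : R ⊗[ℚ] E) : G.Mem (toMat R (elementary b i j ρ)) := by
  induction ρ using TensorProduct.induction_on with
  | zero =>
    have : elementary b i j (0 : R ⊗[ℚ] E) = 1 := by rw [elementary, map_zero, zero_mul, add_zero]
    rw [this, map_one]
    exact AlgSubgroup.Mem.one
  | add ρ σ h1 h2 =>
    rw [elementary_add b hij, map_mul]
    exact h1.mul h2
  | tmul r e =>
    have hsq : nilp b i j * nilp b i j = 0 := by
      ext w
      rw [Module.End.mul_apply, nilp_apply, nilp_apply, map_smul, Module.Basis.repr_self,
        Finsupp.smul_apply, Finsupp.single_eq_of_ne hij.symm]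
      simp
    have htr : LinearMap.trace E W (nilp b i j) = 0 := by
      have : Module.Finite E W := Module.Finite.of_basis b
      exact (LinearMap.isNilpotent_trace_of_isNilpotent ⟨2, by rw [sq, hsq]⟩).eq_zero
    let X : Module.End ℚ W := (e • nilp b i j).restrictScalars ℚ
    have hX : X ∈ G.lie := hG X ⟨e • nilp b i j, rfl, by rw [map_smul, htr, smul_zero]⟩
    have hXX : X * X = 0 := by
      have h : (e • nilp b i j) * (e • nilp b i j) = 0 := by
        rw [smul_mul_smul_comm, hsq, smul_zero]
      exact LinearMap.ext fun w => LinearMap.congr_fun h w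
    have := (AlgSubgroup.mem_lie_iff.1 hX).mem_of_sq_eq_zero
      (by rw [← map_mul, hXX, map_zero]) r
    convert this using 1
    rw [elementary, map_add, map_one, ← toMat_baseChange, ← map_smul]
    congr 2
    ext w : 3
    simp [tensorAction_tmul, X, TensorProduct.smul_tmul']

theorem mem_of_isLocalRing [IsLocalRing R] (hG : ∀ X ∈ slOver ℚ E W, X ∈ G.lie)
    {u : LinearMap.GeneralLinearGroup R (R ⊗[ℚ] W)}
    (hu : ∀ x y, detForm b (u.1 x) (u.1 y) = detForm b x y)
    (hlin : ∀ (ρ : R ⊗[ℚ] E) x, u.1 (tensorAction E W R ρ x) = tensorAction E W R ρ (u.1 x)) :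
    u ∈ G.pts R := by
  have hcoord : ∀ k x, coordR b R k (u.1 x) = coordR b R 0 x * coordR b R k (u.1 (1 ⊗ₜ b 0)) +
      coordR b R 1 x * coordR b R k (u.1 (1 ⊗ₜ b 1)) := by
    intro k x
    nth_rewrite 1 [← sum_tensorAction_coordR b x]
    rw [map_add, hlin, hlin, map_add, coordR_tensorAction, coordR_tensorAction]
  obtain ⟨A, hA⟩ : ∃ A, A = coordR b R 0 (u.1 (1 ⊗ₜ b 0)) := ⟨_, rfl⟩
  obtain ⟨B, hB⟩ : ∃ B, B = coordR b R 0 (u.1 (1 ⊗ₜ b 1)) := ⟨_, rfl⟩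
  obtain ⟨C, hC⟩ : ∃ C, C = coordR b R 1 (u.1 (1 ⊗ₜ b 0)) := ⟨_, rfl⟩
  obtain ⟨D, hD⟩ : ∃ D, D = coordR b R 1 (u.1 (1 ⊗ₜ b 1)) := ⟨_, rfl⟩
  have hdet : A * D - B * C = 1 := by
    have h := hu (1 ⊗ₜ b 0) (1 ⊗ₜ b 1)
    simp only [detForm, coordR_basis, ← hA, ← hB, ← hC, ← hD] at h
    simp at h
    linear_combination h
  -- A local `R` makes `R ⊗ E` semilocal. Adding `τ` times the second column to the first therefore
  -- makes the lower left entry a unit.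
  obtain ⟨t, ht⟩ := exists_isUnit_add_smul (finite_maximalSpectrum_of_finite R (R ⊗[ℚ] E)) hdet
  obtain ⟨v, hv⟩ := ht.exists_left_inv
  obtain ⟨τ, hτ⟩ : ∃ τ : R ⊗[ℚ] E, τ = algebraMap ℚ _ t := ⟨_, rfl⟩
  rw [Algebra.smul_def, ← hτ] at hv
  -- For determinant one and lower left entry `c` with inverse `v`, the matrix `(a B; c D)` is the
  -- product of the elementary matrices with parameters `(a - 1)v`, `c`, `(D - 1)v`. The last factor
  -- `-τ` undoes the column operation.
  have key : u.1 = elementary b 0 1 ((A + τ * B - 1) * v) * elementary b 1 0 (C + τ * D) *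
      elementary b 0 1 ((D - 1) * v) * elementary b 1 0 (-τ) := by
    refine LinearMap.ext fun x => ?_
    apply coordR_ext b
    · rw [hcoord]
      simp only [Module.End.mul_apply, coordR_elementary, ← hA, ← hB]
      simp
      linear_combination (-(A + τ * B - 1) *
        (coordR b R 0 x + (D - 1) * v * (coordR b R 1 x - τ * coordR b R 0 x))
        - B * (coordR b R 1 x - τ * coordR b R 0 x)) * hv -
        v * (coordR b R 1 x - τ * coordR b R 0 x) * hdet
    · rw [hcoord]
      simp only [Module.End.mul_apply, coordR_elementary, ← hC, ← hD]
      simp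
      linear_combination (-(D - 1) * (coordR b R 1 x - τ * coordR b R 0 x)) * hv
  rw [AlgSubgroup.mem_pts_iff]
  rw [key, map_mul, map_mul, map_mul]
  exact (((elementary_mem hG (by decide) _).mul (elementary_mem hG (by decide) _)).mul
    (elementary_mem hG (by decide) _)).mul (elementary_mem hG (by decide) _)

/-- An algebraic subgroup whose Lie algebra contains `sl(W/E)` contains `Res SL(W/E)`. -/
theorem resSL_le (hG : ∀ X ∈ slOver ℚ E W, X ∈ G.lie) (b : Module.Basis (Fin 2) E W) :
    resSL E W R ≤ G.pts R := by
  intro u hu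
  rw [AlgSubgroup.mem_pts_iff, AlgSubgroup.mem_iff]
  -- The value of an equation at `u` is an element of `R`, and it vanishes once it vanishes in every
  -- localization at a maximal ideal.
  refine ⟨u.isUnit.map (toMat R), fun p hp => eq_zero_of_localization _ fun J hJ => ?_⟩
  let L := Localization.AtPrime J
  let φ : R →ₐ[ℚ] L := (algebraMap R L).toRatAlgHom
  rw [resSL_eq b, AlgSubgroup.mem_pts_iff] at hu
  obtain ⟨v, hv, hvu⟩ := hu.map φ
  rw [← resSL_eq b] at hv
  have hv' : v ∈ G.pts L := by
    have h1 := (mem_resSL_iff b v).1 hv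
    obtain ⟨w, hw, -⟩ := hv
    refine mem_of_isLocalRing (b := b) hG h1 fun ρ x => ?_
    let _ := tensorModule E W L
    have h2 := w.map_smul ρ x
    rw [hw, hw] at h2
    exact h2
  rw [AlgSubgroup.mem_pts_iff, AlgSubgroup.mem_iff] at hv'
  have h3 := hv'.2 p hp
  rw [hvu, entries_map, ← MvPolynomial.comp_aeval_apply] at h3
  exact h3

end QGroup

/-! ### Rational components of vectors and forms. -/

/-- A vector over an extension `L` of `ℚ` is a combination of its rational components. -/
theorem mem_span_rational_components {ι L : Type*} [Finite ι] [Field L] [Algebra ℚ L] (x : ι → L) :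
    x ∈ Submodule.span L
      (Set.range fun (l : L →ₗ[ℚ] ℚ) (i : ι) => algebraMap ℚ L (l (x i))) := by
  classical
  have := Fintype.ofFinite ι
  let c := Module.Basis.ofVectorSpace ℚ L
  -- Only finitely many members of a `ℚ`-basis of `L` occur in the coordinates of `x`; the
  -- coordinate functionals of these give the combination.
  let s := Finset.univ.biUnion fun i => (c.repr (x i)).support
  have hx : x = ∑ m ∈ s, c m • fun i => algebraMap ℚ L (c.coord m (x i)) := by
    funext i
    have h1 := c.linearCombination_repr (x i)
    rw [Finsupp.linearCombination_apply, Finsupp.sum_of_support_subset (s := s)] at h1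
    · rw [Finset.sum_apply]
      nth_rewrite 1 [← h1]
      refine Finset.sum_congr rfl fun m _ => ?_
      simp [Algebra.smul_def, mul_comm]
    · exact Finset.subset_biUnion_of_mem (fun i => (c.repr (x i)).support) (Finset.mem_univ i)
    · simp
  rw [hx]
  exact Submodule.sum_mem _ fun m _ => Submodule.smul_mem _ _
    (Submodule.subset_span ⟨c.coord m, by rw [← hx]⟩)

namespace LinearMap.BilinForm

variable {k W : Type*} [Field k] [AddCommGroup W] [Module k W]

theorem isAlt_iff_neg [CharZero k] (B : LinearMap.BilinForm k W) :
    B.IsAlt ↔ ∀ x y, B x y = - B y x := by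
  constructor
  · intro h x y
    rw [LinearMap.IsAlt.neg h]
  · intro h x
    have := h x x
    exact self_eq_neg.1 this

theorem isAlt_baseChange {W : Type*} [AddCommGroup W] [Module ℚ W] {L : Type*} [Field L]
    [Algebra ℚ L] {B : LinearMap.BilinForm ℚ W} (hB : B.IsAlt) :
    (LinearMap.BilinForm.baseChange L B).IsAlt := by
  have : CharZero L := charZero_of_injective_algebraMap (algebraMap ℚ L).injective
  rw [isAlt_iff_neg] at hB ⊢
  intro x y
  induction x using TensorProduct.induction_on with
  | zero => simp
  | add x z h1 h2 => rw [map_add, LinearMap.add_apply, h1, h2, map_add, neg_add]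
  | tmul r w =>
    induction y using TensorProduct.induction_on with
    | zero => simp
    | add x z h1 h2 => rw [map_add, h1, h2, map_add, LinearMap.add_apply, neg_add]
    | tmul s v =>
      rw [LinearMap.BilinForm.baseChange_tmul, LinearMap.BilinForm.baseChange_tmul, hB w v,
        mul_comm s r, neg_smul]

variable {L : Type*} [Field L] [Algebra ℚ L] {W : Type*} [AddCommGroup W] [Module ℚ W]

/-- A rational component of a bilinear form on `L ⊗ W`. -/
def component (l : L →ₗ[ℚ] ℚ) (B : LinearMap.BilinForm L (L ⊗[ℚ] W)) : LinearMap.BilinForm ℚ W :=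
  LinearMap.mk₂ ℚ (fun x y => l (B (1 ⊗ₜ x) (1 ⊗ₜ y)))
    (fun x y z => by rw [TensorProduct.tmul_add, map_add, LinearMap.add_apply, map_add])
    (fun c x y => by
      rw [← map_smul, TensorProduct.tmul_smul, ← algebraMap_smul L c, map_smul,
        LinearMap.smul_apply, algebraMap_smul])
    (fun x y z => by rw [TensorProduct.tmul_add, map_add, map_add])
    (fun c x y => by
      rw [← map_smul, TensorProduct.tmul_smul, ← algebraMap_smul L c, map_smul, algebraMap_smul])

theorem component_apply (l : L →ₗ[ℚ] ℚ) (B : LinearMap.BilinForm L (L ⊗[ℚ] W)) (x y : W) :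
    component l B x y = l (B (1 ⊗ₜ x) (1 ⊗ₜ y)) := rfl

/-- The Gram matrix in a rational basis reduces this to `mem_span_rational_components`. -/
theorem mem_span_components [Module.Finite ℚ W] (B : LinearMap.BilinForm L (L ⊗[ℚ] W)) :
    B ∈ Submodule.span L
      (Set.range fun l : L →ₗ[ℚ] ℚ => LinearMap.BilinForm.baseChange L (component l B)) := by
  let b := Module.finBasis ℚ W
  let n := Fin (Module.finrank ℚ W)
  let x : n × n → L := fun ij => B (1 ⊗ₜ b ij.1) (1 ⊗ₜ b ij.2)
  let F : (n × n → L) →ₗ[L] LinearMap.BilinForm L (L ⊗[ℚ] W) :=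
    (LinearMap.BilinForm.toMatrix (b.baseChange L)).symm.toLinearMap ∘ₗ
      (LinearEquiv.curry L L n n).toLinearMap
  have hF : ∀ x i j, F x (1 ⊗ₜ b i) (1 ⊗ₜ b j) = x (i, j) := by
    intro x i j
    have h1 : LinearMap.BilinForm.toMatrix (b.baseChange L) (F x) = fun i j => x (i, j) :=
      LinearEquiv.apply_symm_apply (LinearMap.BilinForm.toMatrix (b.baseChange L)) _
    replace h1 := congrFun (congrFun h1 i) j
    rwa [LinearMap.BilinForm.toMatrix_apply, Module.Basis.baseChange_apply,
      Module.Basis.baseChange_apply] at h1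
  have hext : ∀ B B' : LinearMap.BilinForm L (L ⊗[ℚ] W),
      (∀ i j, B (1 ⊗ₜ b i) (1 ⊗ₜ b j) = B' (1 ⊗ₜ b i) (1 ⊗ₜ b j)) → B = B' := by
    intro B B' h
    refine LinearMap.BilinForm.ext_basis (b.baseChange L) fun i j => ?_
    simpa [Module.Basis.baseChange_apply] using h i j
  have h2 := Submodule.mem_map_of_mem (f := F) (mem_span_rational_components x)
  rw [Submodule.map_span, ← Set.range_comp] at h2
  convert h2 using 2
  on_goal 2 => exact hext _ _ fun i j => (hF x i j).symm
  · congr 1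
    funext l
    refine hext _ _ fun i j => ?_
    rw [Function.comp_apply, hF, LinearMap.BilinForm.baseChange_tmul, component_apply,
      Algebra.smul_def, mul_one, mul_one]

end LinearMap.BilinForm

/-! ### The Hodge decomposition of alternating forms. -/

namespace ComplexTorus

variable {V : Type*} [NormedAddCommGroup V] [NormedSpace ℂ V] [FiniteDimensional ℂ V]
  (Λ : Submodule ℤ V) [DiscreteTopology Λ] [IsZLattice ℝ Λ]

theorem realEquiv_mulC (z : ℂ) (x : H1R Λ) : realEquiv Λ (mulC Λ z x) = z • realEquiv Λ x := by
  simp [mulC, LinearEquiv.conjAlgEquiv]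

/-- The inclusion of `Λ_ℝ` into `Λ_ℂ`. -/
def emb (x : H1R Λ) : H1C Λ :=
  TensorProduct.AlgebraTensorModule.cancelBaseChange ℚ ℝ ℂ ℂ (H1Q Λ) (1 ⊗ₜ x)

theorem emb_add (x y : H1R Λ) : emb Λ (x + y) = emb Λ x + emb Λ y := by
  rw [emb, TensorProduct.tmul_add, map_add]; rfl

theorem emb_smul (r : ℝ) (x : H1R Λ) : emb Λ (r • x) = (r : ℂ) • emb Λ x := by
  rw [emb, emb, ← map_smul, TensorProduct.tmul_smul, TensorProduct.smul_tmul',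
    TensorProduct.smul_tmul']
  simp

theorem emb_tmul (r : ℝ) (w : H1Q Λ) : emb Λ (r ⊗ₜ w) = (r : ℂ) ⊗ₜ w := by
  simp [emb]

theorem JC_emb (x : H1R Λ) : JC Λ (emb Λ x) = emb Λ (mulC Λ Complex.I x) := by
  simp [JC, emb]

/-- The `ℂ`-linear map `Λ_ℂ → V`. -/
def projV : H1C Λ →ₗ[ℂ] V :=
  (realEquiv Λ).toLinearMap.liftBaseChange ℂ ∘ₗ
    (TensorProduct.AlgebraTensorModule.cancelBaseChange ℚ ℝ ℂ ℂ (H1Q Λ)).symm.toLinearMap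

theorem projV_emb (x : H1R Λ) : projV Λ (emb Λ x) = realEquiv Λ x := by
  simp [projV, emb]

theorem projV_surjective : Function.Surjective (projV Λ) := fun v =>
  ⟨emb Λ ((realEquiv Λ).symm v), by rw [projV_emb, LinearEquiv.apply_symm_apply]⟩

/-- `ℂ`-linear maps on `Λ_ℂ` are determined on the rational vectors. -/
theorem ext_one_tmul {M : Type*} [AddCommGroup M] [Module ℂ M] {f f' : H1C Λ →ₗ[ℂ] M}
    (h : ∀ w : H1Q Λ, f (1 ⊗ₜ w) = f' (1 ⊗ₜ w)) : f = f' := by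
  refine LinearMap.ext fun x => ?_
  induction x using TensorProduct.induction_on with
  | zero => rw [map_zero, map_zero]
  | add x y h1 h2 => rw [map_add, map_add, h1, h2]
  | tmul c w =>
    have : c ⊗ₜ[ℚ] w = c • ((1 : ℂ) ⊗ₜ[ℚ] w) := by
      rw [TensorProduct.smul_tmul', smul_eq_mul, mul_one]
    rw [this, map_smul, map_smul, h]

theorem ext_emb {M : Type*} [AddCommGroup M] [Module ℂ M] {f f' : H1C Λ →ₗ[ℂ] M}
    (h : ∀ x : H1R Λ, f (emb Λ x) = f' (emb Λ x)) : f = f' :=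
  ext_one_tmul Λ fun w => by simpa [emb_tmul] using h (1 ⊗ₜ w)

theorem mulC_I_mul_self : mulC Λ Complex.I * mulC Λ Complex.I = -1 := by
  rw [← map_mul, Complex.I_mul_I, map_neg, map_one]

theorem projV_JC (x : H1C Λ) : projV Λ (JC Λ x) = Complex.I • projV Λ x := by
  have : projV Λ ∘ₗ JC Λ = Complex.I • projV Λ := ext_emb Λ fun x => by
    rw [LinearMap.comp_apply, JC_emb, projV_emb, realEquiv_mulC, LinearMap.smul_apply, projV_emb]
  exact LinearMap.congr_fun this x

theorem projV_of_mem_H0m1 {x : H1C Λ} (hx : x ∈ H0m1 Λ) : projV Λ x = 0 := by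
  have h1 := projV_JC Λ x
  rw [Module.End.mem_eigenspace_iff.1 hx, map_smul, neg_smul] at h1
  have h2 : (2 * Complex.I) • projV Λ x = 0 := by
    rw [two_mul, add_smul]
    nth_rewrite 1 [← h1]
    exact neg_add_cancel _
  exact (smul_eq_zero.1 h2).resolve_left (mul_ne_zero two_ne_zero Complex.I_ne_zero)

/-- The projection of `Λ_ℂ` onto `H_{-1,0}` along `H_{0,-1}`. -/
def pr : Module.End ℂ (H1C Λ) := (1 / 2 : ℂ) • (1 - Complex.I • JC Λ)

/-- The projection of `Λ_ℂ` onto `H_{0,-1}` along `H_{-1,0}`. -/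
def prBar : Module.End ℂ (H1C Λ) := (1 / 2 : ℂ) • (1 + Complex.I • JC Λ)

theorem pr_add_prBar (x : H1C Λ) : pr Λ x + prBar Λ x = x := by
  simp only [pr, prBar, LinearMap.smul_apply, LinearMap.sub_apply, LinearMap.add_apply,
    Module.End.one_apply]
  module

theorem pr_of_mem_H0m1 {x : H1C Λ} (hx : x ∈ H0m1 Λ) : pr Λ x = 0 := by
  simp only [pr, LinearMap.smul_apply, LinearMap.sub_apply, Module.End.one_apply,
    Module.End.mem_eigenspace_iff.1 hx, smul_smul, mul_neg, Complex.I_mul_I]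
  simp

theorem prBar_of_mem_Hm10 {x : H1C Λ} (hx : x ∈ Hm10 Λ) : prBar Λ x = 0 := by
  simp only [prBar, LinearMap.smul_apply, LinearMap.add_apply, Module.End.one_apply,
    Module.End.mem_eigenspace_iff.1 hx, smul_smul, Complex.I_mul_I]
  simp

variable {Λ}

theorem isAlt_of_mem_complexify {H : Submodule ℚ (LinearMap.BilinForm ℚ (H1Q Λ))}
    (hH : H ≤ altForms ℚ (H1Q Λ)) {B : LinearMap.BilinForm ℂ (H1C Λ)}
    (hB : B ∈ complexify Λ H) : B ∈ altForms ℂ (H1C Λ) := by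
  have h : complexify Λ H ≤ altForms ℂ (H1C Λ) := by
    rw [complexify, Submodule.span_le]
    rintro _ ⟨C, hC, rfl⟩
    exact LinearMap.BilinForm.isAlt_baseChange (hH hC)
  exact h hB

/-- Used for `H` defined by rational linear conditions: a complex form satisfying them has
components that satisfy them too. -/
theorem mem_complexify {H : Submodule ℚ (LinearMap.BilinForm ℚ (H1Q Λ))}
    {B : LinearMap.BilinForm ℂ (H1C Λ)}
    (h : ∀ l : ℂ →ₗ[ℚ] ℚ, LinearMap.BilinForm.component l B ∈ H) : B ∈ complexify Λ H := by
  have h1 := LinearMap.BilinForm.mem_span_components B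
  refine Submodule.span_mono ?_ h1
  rintro _ ⟨l, rfl⟩
  exact ⟨_, h l, rfl⟩

theorem isAlt_comp {B : LinearMap.BilinForm ℂ (H1C Λ)} (hB : B.IsAlt)
    (f : Module.End ℂ (H1C Λ)) : (B.comp f f).IsAlt := fun x => hB (f x)

theorem comp_pr_mem_H20 {B : LinearMap.BilinForm ℂ (H1C Λ)} (hB : B.IsAlt) :
    B.comp (pr Λ) (pr Λ) ∈ H20 Λ :=
  ⟨isAlt_comp hB _, fun x hx y => by
    rw [LinearMap.BilinForm.comp_apply, pr_of_mem_H0m1 Λ hx, map_zero, LinearMap.zero_apply]⟩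

/-- A space of alternating forms whose complexification is stable under the Hodge projections is a
Hodge substructure. -/
theorem isHodgeSub_of_comp_mem {H : Submodule ℚ (LinearMap.BilinForm ℚ (H1Q Λ))}
    (hH : H ≤ altForms ℚ (H1Q Λ))
    (h1 : ∀ B ∈ complexify Λ H, B.comp (pr Λ) (pr Λ) ∈ complexify Λ H)
    (h2 : ∀ B ∈ complexify Λ H, B.comp (prBar Λ) (prBar Λ) ∈ complexify Λ H) :
    IsHodgeSub Λ H := by
  refine ⟨hH, le_antisymm ?_ ?_⟩
  · intro B hB
    have hB' := isAlt_of_mem_complexify hH hB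
    have hneg := (LinearMap.BilinForm.isAlt_iff_neg B).1 hB'
    -- The outer terms are the parts of type `(2,0)` and `(0,2)`; the remainder pairs `pr` with
    -- `prBar` only, so it has type `(1,1)`.
    have hsplit : B = B.comp (pr Λ) (pr Λ) +
        (B - B.comp (pr Λ) (pr Λ) - B.comp (prBar Λ) (prBar Λ)) +
        B.comp (prBar Λ) (prBar Λ) := by abel
    rw [hsplit]
    have hmid : ∀ x y, (B - B.comp (pr Λ) (pr Λ) - B.comp (prBar Λ) (prBar Λ)) x y =
        B (pr Λ x) (prBar Λ y) + B (prBar Λ x) (pr Λ y) := by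
      intro x y
      have : B x y = B (pr Λ x + prBar Λ x) (pr Λ y + prBar Λ y) := by
        rw [pr_add_prBar, pr_add_prBar]
      simp only [LinearMap.sub_apply, LinearMap.BilinForm.comp_apply, this, map_add,
        LinearMap.add_apply]
      ring
    refine Submodule.add_mem_sup (Submodule.add_mem_sup ⟨h1 B hB, comp_pr_mem_H20 hB'⟩
      ⟨sub_mem (sub_mem hB (h1 B hB)) (h2 B hB), ?_, ?_, ?_⟩) ⟨h2 B hB, isAlt_comp hB' _, ?_⟩
    · exact sub_mem (sub_mem hB' (isAlt_comp hB' _)) (isAlt_comp hB' _)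
    · intro x hx y hy
      rw [hmid, prBar_of_mem_Hm10 Λ hx, prBar_of_mem_Hm10 Λ hy]
      simp
    · intro x hx y hy
      rw [hmid, pr_of_mem_H0m1 Λ hx, pr_of_mem_H0m1 Λ hy]
      simp
    · intro x hx y
      rw [LinearMap.BilinForm.comp_apply, prBar_of_mem_Hm10 Λ hx, map_zero, LinearMap.zero_apply]
  · exact sup_le (sup_le inf_le_left inf_le_left) inf_le_left

/-- The alternating form `f ∧ f'` on `Λ_ℂ` for linear functionals `f`, `f'` on `V`. -/
def wedge (f f' : V →ₗ[ℂ] ℂ) : LinearMap.BilinForm ℂ (H1C Λ) :=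
  LinearMap.mk₂ ℂ (fun x y => f (projV Λ x) * f' (projV Λ y) - f' (projV Λ x) * f (projV Λ y))
    (fun x y z => by simp only [map_add]; ring)
    (fun c x y => by simp only [map_smul, smul_eq_mul]; ring)
    (fun x y z => by simp only [map_add]; ring)
    (fun c x y => by simp only [map_smul, smul_eq_mul]; ring)

theorem wedge_apply (f f' : V →ₗ[ℂ] ℂ) (x y : H1C Λ) : wedge f f' x y =
    f (projV Λ x) * f' (projV Λ y) - f' (projV Λ x) * f (projV Λ y) := rfl

theorem wedge_mem_H20 (f f' : V →ₗ[ℂ] ℂ) : wedge f f' ∈ H20 Λ := by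
  refine ⟨fun x => ?_, fun x hx y => ?_⟩
  · rw [wedge_apply]; ring
  · rw [wedge_apply, projV_of_mem_H0m1 Λ hx]; simp

end ComplexTorus

/-! ### Subtori of a 2-simple torus. -/

namespace ComplexTorus

variable {V : Type*} [NormedAddCommGroup V] [NormedSpace ℂ V] [FiniteDimensional ℂ V]
  {Λ : Submodule ℤ V} [DiscreteTopology Λ] [IsZLattice ℝ Λ]

theorem finrank_H1Q : Module.finrank ℚ (H1Q Λ) = 2 * Module.finrank ℂ V := by
  rw [← Module.finrank_baseChange (R := ℝ) (S := ℚ) (M' := H1Q Λ), (realEquiv Λ).finrank_eq,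
    finrank_real_of_complex]

theorem realEquiv_tmul_eq_zero {w : H1Q Λ} (h : realEquiv Λ (1 ⊗ₜ w) = 0) : w = 0 := by
  rw [LinearEquiv.map_eq_zero_iff] at h
  have := Module.FaithfullyFlat.tensorProduct_mk_injective (A := ℚ) (B := ℝ) (H1Q Λ)
  apply this
  simpa using h

/-- Two vectors on which all products `f ∧ f'` vanish are proportional. -/
theorem mem_span_singleton_of_wedge_eq_zero {v w : V} (hw : w ≠ 0)
    (h : ∀ f f' : V →ₗ[ℂ] ℂ, f w * f' v - f' w * f v = 0) : v ∈ Submodule.span ℂ {w} := by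
  obtain ⟨f, hf⟩ : ∃ f : V →ₗ[ℂ] ℂ, f w ≠ 0 := by
    by_contra! h
    exact hw ((Module.forall_dual_apply_eq_zero_iff ℂ _).1 h)
  refine Submodule.mem_span_singleton.2 ⟨f v / f w, ?_⟩
  rw [← sub_eq_zero]
  refine (Module.forall_dual_apply_eq_zero_iff ℂ _).1 fun φ => ?_
  rw [map_sub, map_smul, smul_eq_mul]
  field_simp
  linear_combination -h f φ

theorem projV_one_tmul (w : H1Q Λ) : projV Λ (1 ⊗ₜ w) = realEquiv Λ (1 ⊗ₜ w) := by
  have := projV_emb Λ (1 ⊗ₜ w)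
  rwa [emb_tmul, Complex.ofReal_one] at this

section Subspace

/-- The alternating forms with a given subspace in the kernel. -/
def formsKilling (U : Submodule ℚ (H1Q Λ)) : Submodule ℚ (LinearMap.BilinForm ℚ (H1Q Λ)) where
  carrier := {B | B ∈ altForms ℚ (H1Q Λ) ∧ ∀ u ∈ U, ∀ y, B u y = 0}
  zero_mem' := ⟨zero_mem _, fun _ _ _ => rfl⟩
  add_mem' := fun {A B} hA hB => ⟨add_mem hA.1 hB.1, fun x hx y => by
    rw [LinearMap.add_apply, LinearMap.add_apply, hA.2 x hx y, hB.2 x hx y, add_zero]⟩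
  smul_mem' := fun c B hB => ⟨Submodule.smul_mem _ c hB.1, fun x hx y => by
    rw [LinearMap.smul_apply, LinearMap.smul_apply, hB.2 x hx y, smul_zero]⟩

variable {U : Submodule ℚ (H1Q Λ)}

theorem formsKilling_le : formsKilling U ≤ altForms ℚ (H1Q Λ) := fun _ h => h.1

theorem mem_complexify_formsKilling {B : LinearMap.BilinForm ℂ (H1C Λ)} :
    B ∈ complexify Λ (formsKilling U) ↔ B.IsAlt ∧ ∀ u ∈ U, ∀ y, B (1 ⊗ₜ u) y = 0 := by
  constructor
  · intro hB
    refine ⟨isAlt_of_mem_complexify formsKilling_le hB, fun u hu y => ?_⟩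
    induction hB using Submodule.span_induction with
    | mem B hB =>
      obtain ⟨C, hC, rfl⟩ := hB
      induction y using TensorProduct.induction_on with
      | zero => simp
      | add x y h1 h2 => rw [map_add, h1, h2, add_zero]
      | tmul c w => rw [LinearMap.BilinForm.baseChange_tmul, hC.2 u hu, zero_smul]
    | zero => simp
    | add A B _ _ h1 h2 => rw [LinearMap.add_apply, LinearMap.add_apply, h1, h2, add_zero]
    | smul c B _ h => rw [LinearMap.smul_apply, LinearMap.smul_apply, h, smul_zero]
  · rintro ⟨h1, h2⟩
    refine mem_complexify fun l => ⟨fun x => ?_, fun u hu y => ?_⟩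
    · rw [LinearMap.BilinForm.component_apply, h1, map_zero]
    · rw [LinearMap.BilinForm.component_apply, h2 u hu, map_zero]

/-- The real span of `U` contains `J U`, so the Hodge projections carry `U` into its complex span,
where the complexified forms still vanish. -/
theorem isHodgeSub_formsKilling
    (hU : ∀ u ∈ U, mulC Λ Complex.I (1 ⊗ₜ u) ∈
      Submodule.span ℝ ((fun w : H1Q Λ => ((1 : ℝ) ⊗ₜ[ℚ] w : H1R Λ)) '' U)) :
    IsHodgeSub Λ (formsKilling U) := by
  have hJ : ∀ B ∈ complexify Λ (formsKilling U), ∀ u ∈ U, ∀ y, B (JC Λ (1 ⊗ₜ u)) y = 0 := by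
    intro B hB u hu y
    rw [mem_complexify_formsKilling] at hB
    have h1 : JC Λ (1 ⊗ₜ u) = emb Λ (mulC Λ Complex.I (1 ⊗ₜ u)) := by
      rw [← JC_emb, emb_tmul, Complex.ofReal_one]
    rw [h1]
    have hx := hU u hu
    generalize mulC Λ Complex.I (1 ⊗ₜ u) = x at hx
    have hkill : ∀ (c : ℝ) (x : H1R Λ), B (emb Λ x) y = 0 → B (emb Λ (c • x)) y = 0 := by
      intro c x h
      rw [emb_smul, map_smul, LinearMap.smul_apply, h, smul_zero]
    induction hx using Submodule.span_induction with
    | mem x hx =>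
      obtain ⟨w, hw, rfl⟩ := hx
      rw [emb_tmul, Complex.ofReal_one]
      exact hB.2 w hw y
    | zero =>
      have := emb_smul Λ 0 0
      rw [zero_smul, Complex.ofReal_zero, zero_smul] at this
      rw [this, map_zero, LinearMap.zero_apply]
    | add x x' _ _ h1 h2 => rw [emb_add, map_add, LinearMap.add_apply, h1, h2, add_zero]
    | smul c x _ h => exact hkill c x h
  refine isHodgeSub_of_comp_mem formsKilling_le ?_ ?_
  · intro B hB
    have hB' := mem_complexify_formsKilling.1 hB
    refine mem_complexify_formsKilling.2 ⟨isAlt_comp hB'.1 _, fun u hu y => ?_⟩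
    rw [LinearMap.BilinForm.comp_apply]
    generalize pr Λ y = z
    simp [pr, hB'.2 u hu, hJ B hB u hu]
  · intro B hB
    have hB' := mem_complexify_formsKilling.1 hB
    refine mem_complexify_formsKilling.2 ⟨isAlt_comp hB'.1 _, fun u hu y => ?_⟩
    rw [LinearMap.BilinForm.comp_apply]
    generalize prBar Λ y = z
    simp [prBar, hB'.2 u hu, hJ B hB u hu]

/-- A `2`-simple torus of dimension `g > 2` has no subtorus of real dimension `d` with
`0 < d ≤ g`. -/
theorem eq_bot_of_isTwoSimple (hg : 2 < Module.finrank ℂ V) (hT : IsTwoSimple Λ)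
    (hU : ∀ u ∈ U, mulC Λ Complex.I (1 ⊗ₜ u) ∈
      Submodule.span ℝ ((fun w : H1Q Λ => ((1 : ℝ) ⊗ₜ[ℚ] w : H1R Λ)) '' U))
    (hd : Module.finrank ℚ U ≤ Module.finrank ℂ V) : U = ⊥ := by
  let ι : H1Q Λ → V := fun w => realEquiv Λ (1 ⊗ₜ w)
  have hI : ∀ v ∈ Submodule.span ℝ (ι '' U), Complex.I • v ∈ Submodule.span ℝ (ι '' U) := by
    intro v hv
    induction hv using Submodule.span_induction with
    | mem v hv =>
      obtain ⟨u, hu, rfl⟩ := hv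
      have h1 := Submodule.mem_map_of_mem (f := (realEquiv Λ).toLinearMap) (hU u hu)
      rw [Submodule.map_span, ← Set.image_comp] at h1
      rw [← realEquiv_mulC]
      exact h1
    | zero => rw [smul_zero]; exact zero_mem _
    | add x y _ _ hx hy => rw [smul_add]; exact add_mem hx hy
    | smul c x _ hx => rw [smul_comm]; exact Submodule.smul_mem _ c hx
  -- Being stable under `J`, the real span of `U` is a complex subspace, of complex dimension at
  -- most half the rank of `U`.
  let P : Submodule ℂ V :=
    { (Submodule.span ℝ (ι '' U)) with
      smul_mem' := fun c v hv => by
        have h1 : c • v = c.re • v + c.im • (Complex.I • v) := by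
          nth_rewrite 1 [← Complex.re_add_im c]
          rw [add_smul, mul_smul, Complex.coe_smul, Complex.coe_smul]
        rw [h1]
        exact add_mem (Submodule.smul_mem _ _ hv) (Submodule.smul_mem _ _ (hI v hv)) }
  have hP : 2 * Module.finrank ℂ P ≤ Module.finrank ℂ V := by
    rw [← finrank_real_of_complex]
    refine le_trans ?_ hd
    let β := Module.finBasis ℚ U
    have h1 : Submodule.span ℝ (ι '' U) ≤
        Submodule.span ℝ (Set.range fun i => ι (β i : H1Q Λ)) := by
      rw [Submodule.span_le]
      rintro _ ⟨u, hu, rfl⟩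
      have h2 : u = ∑ i, β.repr ⟨u, hu⟩ i • (β i : H1Q Λ) := by
        have := congrArg U.subtype (β.sum_repr ⟨u, hu⟩)
        rw [map_sum] at this
        exact this.symm
      have h3 : ι u = ∑ i, (β.repr ⟨u, hu⟩ i : ℝ) • ι (β i : H1Q Λ) := by
        conv_lhs => rw [h2]
        simp only [ι]
        rw [TensorProduct.tmul_sum, map_sum]
        refine Finset.sum_congr rfl fun i _ => ?_
        rw [← map_smul, TensorProduct.smul_tmul', TensorProduct.tmul_smul,
          TensorProduct.smul_tmul']
        congr 2
      rw [h3]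
      exact Submodule.sum_mem _ fun i _ => Submodule.smul_mem _ _ (Submodule.subset_span ⟨i, rfl⟩)
    have h4 := (Submodule.finrank_mono h1).trans
      (finrank_range_le_card (R := ℝ) fun i => ι (β i : H1Q Λ))
    rw [Fintype.card_fin] at h4
    exact h4
  have hPι : ∀ u ∈ U, ι u ∈ P := fun u hu => Submodule.subset_span ⟨u, hu, rfl⟩
  -- The codimension of `P` is at least `g/2 > 1`, so two independent functionals vanish on `P`, and
  -- their wedge is a nonzero `(2,0)`-form killing `U`.
  obtain ⟨f, f', hf, hf', hne⟩ : ∃ f f' : V →ₗ[ℂ] ℂ, (∀ v ∈ P, f v = 0) ∧ (∀ v ∈ P, f' v = 0) ∧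
      ∃ v w, f v * f' w - f' v * f w ≠ 0 := by
    have h1 := Subspace.finrank_add_finrank_dualAnnihilator_eq P
    have h2 : 1 < Module.finrank ℂ P.dualAnnihilator := by omega
    have : Nontrivial P.dualAnnihilator := Module.nontrivial_of_finrank_pos (R := ℂ) (by omega)
    obtain ⟨f, hf⟩ := exists_ne (0 : P.dualAnnihilator)
    obtain ⟨f', hff'⟩ := exists_linearIndependent_pair_of_one_lt_finrank h2 hf
    refine ⟨f, f', (Submodule.mem_dualAnnihilator _).1 f.2, (Submodule.mem_dualAnnihilator _).1 f'.2,
      ?_⟩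
    by_contra! h
    refine hf (Subtype.ext (LinearMap.ext fun v => ?_))
    have h3 : (f'.1 v) • f + (-(f.1 v)) • f' = 0 := by
      refine Subtype.ext (LinearMap.ext fun w => ?_)
      have := h v w
      change f'.1 v * f.1 w + -(f.1 v) * f'.1 w = 0
      linear_combination -this
    have h4 := (LinearIndependent.pair_iff.1 hff' _ _ h3).2
    exact neg_eq_zero.1 h4
  have hmem : wedge f f' ∈ complexify Λ (formsKilling U) ⊓ H20 Λ := by
    refine ⟨mem_complexify_formsKilling.2 ⟨(wedge_mem_H20 f f').1, fun u hu y => ?_⟩,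
      wedge_mem_H20 f f'⟩
    rw [wedge_apply, projV_one_tmul, hf _ (hPι u hu), hf' _ (hPι u hu)]
    ring
  have hne' : complexify Λ (formsKilling U) ⊓ H20 Λ ≠ ⊥ := by
    intro h
    rw [h, Submodule.mem_bot] at hmem
    obtain ⟨v, w, hvw⟩ := hne
    obtain ⟨x, rfl⟩ := projV_surjective Λ v
    obtain ⟨y, rfl⟩ := projV_surjective Λ w
    rw [← wedge_apply, hmem] at hvw
    exact hvw rfl
  -- Now every `(2,0)`-form kills `U`. A nonzero `u` in `U` would then be proportional to every
  -- vector of `V`.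
  have hle := hT _ (isHodgeSub_formsKilling hU) hne'
  rw [eq_bot_iff]
  intro u hu
  by_contra hu0
  have hιu : ι u ≠ 0 := fun h => hu0 (realEquiv_tmul_eq_zero h)
  have hspan : ∀ v : V, v ∈ Submodule.span ℂ {ι u} := by
    intro v
    refine mem_span_singleton_of_wedge_eq_zero hιu fun f φ => ?_
    obtain ⟨y, rfl⟩ := projV_surjective Λ v
    have h2 := (mem_complexify_formsKilling.1 (hle (wedge_mem_H20 f φ))).2 u hu y
    rwa [wedge_apply, projV_one_tmul] at h2
  have h1 : Module.finrank ℂ V ≤ 1 := by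
    rw [← finrank_top, ← (Submodule.eq_top_iff'.2 hspan : Submodule.span ℂ {ι u} = ⊤)]
    exact finrank_span_singleton hιu |>.le
  omega

end Subspace

end ComplexTorus

/-! ### Forms balanced over `E` have type `(1,1)`. -/

namespace ComplexTorus

variable {V : Type*} [NormedAddCommGroup V] [NormedSpace ℂ V] [FiniteDimensional ℂ V]
  {Λ : Submodule ℤ V} [DiscreteTopology Λ] [IsZLattice ℝ Λ]

theorem emb_baseChange (X : Module.End ℚ (H1Q Λ)) (x : H1R Λ) :
    emb Λ (X.baseChange ℝ x) = X.baseChange ℂ (emb Λ x) := by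
  induction x using TensorProduct.induction_on with
  | zero => simp [emb]
  | add x y h1 h2 => rw [map_add, emb_add, emb_add, map_add, h1, h2]
  | tmul r w => rw [LinearMap.baseChange_tmul, emb_tmul, emb_tmul, LinearMap.baseChange_tmul]

theorem JC_baseChange {X : Module.End ℚ (H1Q Λ)} (hX : X ∈ End0 Λ) (x : H1C Λ) :
    JC Λ (X.baseChange ℂ x) = X.baseChange ℂ (JC Λ x) := by
  have h : JC Λ ∘ₗ X.baseChange ℂ = X.baseChange ℂ ∘ₗ JC Λ := ext_emb Λ fun x => by
    rw [LinearMap.comp_apply, LinearMap.comp_apply, ← emb_baseChange, JC_emb, JC_emb,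
      ← emb_baseChange]
    exact congrArg (emb Λ) (LinearMap.congr_fun (hX Complex.I) x).symm
  exact LinearMap.congr_fun h x

theorem baseChange_emb_emb (B : LinearMap.BilinForm ℚ (H1Q Λ)) (x y : H1R Λ) :
    LinearMap.BilinForm.baseChange ℂ B (emb Λ x) (emb Λ y) =
      (LinearMap.BilinForm.baseChange ℝ B x y : ℂ) := by
  induction x using TensorProduct.induction_on with
  | zero => simp [emb]
  | add x z h1 h2 => rw [emb_add, map_add, map_add, LinearMap.add_apply, LinearMap.add_apply, h1,
      h2, Complex.ofReal_add]
  | tmul s w =>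
    induction y using TensorProduct.induction_on with
    | zero => simp [emb]
    | add x z h1 h2 => rw [emb_add, map_add, map_add, h1, h2, Complex.ofReal_add]
    | tmul t v =>
      rw [emb_tmul, emb_tmul, LinearMap.BilinForm.baseChange_tmul,
        LinearMap.BilinForm.baseChange_tmul, Rat.smul_def, Rat.smul_def]
      push_cast
      rfl

theorem mulC_eq (z : ℂ) : mulC Λ z = z.re • 1 + z.im • mulC Λ Complex.I := by
  have h : z = z.re • (1 : ℂ) + z.im • Complex.I := by
    simp [Complex.re_add_im]
  nth_rewrite 1 [h]
  rw [map_add, map_smul, map_smul, map_one]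

section Balanced

variable (E : Type*) [Field E] [NumberField E] [Module E (H1Q Λ)]

/-- The operator on `Λ_ℂ` given by the action of an element of `E`. -/
def smulC (e : E) : Module.End ℂ (H1C Λ) :=
  (Algebra.lsmul ℚ ℚ (H1Q Λ) e : Module.End ℚ (H1Q Λ)).baseChange ℂ

theorem smulC_tmul (e : E) (c : ℂ) (w : H1Q Λ) : smulC E e (c ⊗ₜ w) = c ⊗ₜ[ℚ] (e • w) := rfl

variable (Λ) in
/-- The alternating forms `B` with `B(ex, y) = B(x, ey)` for `e ∈ E`. -/
def formsBalanced : Submodule ℚ (LinearMap.BilinForm ℚ (H1Q Λ)) where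
  carrier := {B | B ∈ altForms ℚ (H1Q Λ) ∧ ∀ (e : E) x y, B (e • x) y = B x (e • y)}
  zero_mem' := ⟨zero_mem _, fun _ _ _ => rfl⟩
  add_mem' := fun {A B} hA hB => ⟨add_mem hA.1 hB.1, fun e x y => by
    rw [LinearMap.add_apply, LinearMap.add_apply, hA.2, hB.2]; rfl⟩
  smul_mem' := fun c B hB => ⟨Submodule.smul_mem _ c hB.1, fun e x y => by
    rw [LinearMap.smul_apply, LinearMap.smul_apply, hB.2]; rfl⟩

theorem formsBalanced_le : formsBalanced Λ E ≤ altForms ℚ (H1Q Λ) := fun _ h => h.1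

variable {E}

theorem mem_complexify_formsBalanced {B : LinearMap.BilinForm ℂ (H1C Λ)} :
    B ∈ complexify Λ (formsBalanced Λ E) ↔
      B.IsAlt ∧ ∀ (e : E) x y, B (smulC E e x) y = B x (smulC E e y) := by
  constructor
  · intro hB
    refine ⟨isAlt_of_mem_complexify (formsBalanced_le E) hB, fun e x y => ?_⟩
    induction hB using Submodule.span_induction with
    | mem B hB =>
      obtain ⟨C, hC, rfl⟩ := hB
      induction x using TensorProduct.induction_on with
      | zero => simp
      | add x z h1 h2 => rw [map_add, map_add, map_add, LinearMap.add_apply, LinearMap.add_apply,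
          h1, h2]
      | tmul r v =>
        induction y using TensorProduct.induction_on with
        | zero => simp
        | add x y h1 h2 => rw [map_add, map_add, map_add, h1, h2]
        | tmul c w => rw [smulC_tmul, smulC_tmul, LinearMap.BilinForm.baseChange_tmul,
            LinearMap.BilinForm.baseChange_tmul, hC.2]
    | zero => simp
    | add A B _ _ h1 h2 => rw [LinearMap.add_apply, LinearMap.add_apply, h1, h2]; rfl
    | smul c B _ h => rw [LinearMap.smul_apply, LinearMap.smul_apply, h]; rfl
  · rintro ⟨h1, h2⟩
    refine mem_complexify fun l => ⟨fun x => ?_, fun e x y => ?_⟩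
    · rw [LinearMap.BilinForm.component_apply, h1, map_zero]
    · rw [LinearMap.BilinForm.component_apply, LinearMap.BilinForm.component_apply,
        ← smulC_tmul, h2, smulC_tmul]

theorem comp_mem_complexify_formsBalanced
    {B : LinearMap.BilinForm ℂ (H1C Λ)}
    (hB : B ∈ complexify Λ (formsBalanced Λ E)) {p : Module.End ℂ (H1C Λ)}
    (hp : ∀ (e : E) x, p (smulC E e x) = smulC E e (p x)) :
    B.comp p p ∈ complexify Λ (formsBalanced Λ E) := by
  rw [mem_complexify_formsBalanced] at hB ⊢
  refine ⟨isAlt_comp hB.1 _, fun e x y => ?_⟩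
  rw [LinearMap.BilinForm.comp_apply, LinearMap.BilinForm.comp_apply, hp, hp, hB.2]

theorem pr_smulC
    (hE : ∀ e : E, (Algebra.lsmul ℚ ℚ (H1Q Λ) e : Module.End ℚ (H1Q Λ)) ∈ End0 Λ)
    (e : E) (x : H1C Λ) : pr Λ (smulC E e x) = smulC E e (pr Λ x) := by
  simp only [pr, smulC, LinearMap.smul_apply, LinearMap.sub_apply, Module.End.one_apply,
    JC_baseChange (hE e), map_smul, map_sub]

theorem prBar_smulC
    (hE : ∀ e : E, (Algebra.lsmul ℚ ℚ (H1Q Λ) e : Module.End ℚ (H1Q Λ)) ∈ End0 Λ)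
    (e : E) (x : H1C Λ) : prBar Λ (smulC E e x) = smulC E e (prBar Λ x) := by
  simp only [prBar, smulC, LinearMap.smul_apply, LinearMap.add_apply, Module.End.one_apply,
    JC_baseChange (hE e), map_smul, map_add]

/-- The action of `E` commutes with `J`, hence with both Hodge projections. -/
theorem isHodgeSub_formsBalanced
    (hE : ∀ e : E, (Algebra.lsmul ℚ ℚ (H1Q Λ) e : Module.End ℚ (H1Q Λ)) ∈ End0 Λ)
    : IsHodgeSub Λ (formsBalanced Λ E) :=
  isHodgeSub_of_comp_mem (formsBalanced_le E)
    (fun _ hB => comp_mem_complexify_formsBalanced hB (pr_smulC hE))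
    (fun _ hB => comp_mem_complexify_formsBalanced hB (prBar_smulC hE))

/-- A balanced alternating form vanishes on `(w, ew)`, since `B(ew, w) = B(w, ew) = -B(ew, w)`. If
all `f ∧ f'` are balanced, `ew` lies on the complex line of `w`, so an `E`-basis of two vectors
spans `V` over `ℂ`. -/
theorem finrank_le_two_of_H20_le
    (b : Module.Basis (Fin 2) E (H1Q Λ))
    (h : H20 Λ ≤ complexify Λ (formsBalanced Λ E)) : Module.finrank ℂ V ≤ 2 := by
  let ι : H1Q Λ → V := fun w => realEquiv Λ (1 ⊗ₜ w)
  have h1 : ∀ (e : E) w, ι (e • w) ∈ Submodule.span ℂ {ι w} := by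
    intro e w
    by_cases hw : w = 0
    · simp [hw, ι]
    · refine mem_span_singleton_of_wedge_eq_zero (fun h0 => hw (realEquiv_tmul_eq_zero h0))
        fun f f' => ?_
      have h2 := (mem_complexify_formsBalanced.1 (h (wedge_mem_H20 f f'))).2 e (1 ⊗ₜ w) (1 ⊗ₜ w)
      rw [smulC_tmul, wedge_apply, wedge_apply, projV_one_tmul, projV_one_tmul] at h2
      change f (ι w) * f' (ι (e • w)) - f' (ι w) * f (ι (e • w)) = 0
      linear_combination - h2 / 2
  have h2 : Submodule.span ℂ (Set.range fun i => ι (b i)) = ⊤ := by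
    rw [Submodule.eq_top_iff']
    have h3 : ∀ w, ι w ∈ Submodule.span ℂ (Set.range fun i => ι (b i)) := by
      intro w
      rw [← b.sum_repr w]
      simp only [ι]
      rw [TensorProduct.tmul_sum, map_sum]
      exact Submodule.sum_mem _ fun i _ => Submodule.span_mono
        (Set.singleton_subset_iff.2 (Set.mem_range_self i)) (h1 (b.repr w i) (b i))
    intro v
    obtain ⟨x, rfl⟩ := (realEquiv Λ).surjective v
    induction x using TensorProduct.induction_on with
    | zero => rw [map_zero]; exact zero_mem _
    | add x y hx hy => rw [map_add]; exact add_mem hx hy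
    | tmul r w =>
      have h4 : realEquiv Λ (r ⊗ₜ w) = (r : ℂ) • ι w := by
        rw [Complex.coe_smul, ← map_smul, TensorProduct.smul_tmul', smul_eq_mul, mul_one]
      rw [h4]
      exact Submodule.smul_mem _ _ (h3 w)
  rw [← finrank_top, ← h2]
  exact (finrank_range_le_card (R := ℂ) fun i => ι (b i)).trans_eq (Fintype.card_fin 2)

/-- By 2-simplicity and `g > 2` the space of balanced forms has no `(2,0)` part, so `B(pr x, pr y) =
0`. For real `x`, `y` the real part of this is `¼(B(x, y) - B(Jx, Jy))`. -/
theorem baseChange_mulC_I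
    (hE : ∀ e : E, (Algebra.lsmul ℚ ℚ (H1Q Λ) e : Module.End ℚ (H1Q Λ)) ∈ End0 Λ)
    (hg : 2 < Module.finrank ℂ V) (hT : IsTwoSimple Λ)
    (b : Module.Basis (Fin 2) E (H1Q Λ)) {B : LinearMap.BilinForm ℚ (H1Q Λ)}
    (hB : B ∈ formsBalanced Λ E) (x y : H1R Λ) :
    LinearMap.BilinForm.baseChange ℝ B (mulC Λ Complex.I x) (mulC Λ Complex.I y) =
      LinearMap.BilinForm.baseChange ℝ B x y := by
  have h0 : complexify Λ (formsBalanced Λ E) ⊓ H20 Λ = ⊥ := by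
    by_contra h
    have := finrank_le_two_of_H20_le b (hT _ (isHodgeSub_formsBalanced hE) h)
    omega
  have h1 : LinearMap.BilinForm.baseChange ℂ B ∈ complexify Λ (formsBalanced Λ E) :=
    Submodule.subset_span ⟨B, hB, rfl⟩
  have h2 : (LinearMap.BilinForm.baseChange ℂ B).comp (pr Λ) (pr Λ) = 0 := by
    rw [← Submodule.mem_bot ℂ, ← h0]
    exact ⟨comp_mem_complexify_formsBalanced h1 (pr_smulC hE),
      comp_pr_mem_H20 (isAlt_of_mem_complexify (formsBalanced_le E) h1)⟩
  have h3 := LinearMap.BilinForm.congr_fun h2 (emb Λ x) (emb Λ y)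
  simp only [LinearMap.BilinForm.comp_apply, pr, LinearMap.smul_apply, LinearMap.sub_apply,
    Module.End.one_apply, JC_emb, map_smul, map_sub, baseChange_emb_emb, smul_eq_mul,
    LinearMap.zero_apply] at h3
  have h4 := congrArg Complex.re h3
  simp at h4
  linarith

theorem preserves_mulC
    (hE : ∀ e : E, (Algebra.lsmul ℚ ℚ (H1Q Λ) e : Module.End ℚ (H1Q Λ)) ∈ End0 Λ)
    (hg : 2 < Module.finrank ℂ V) (hT : IsTwoSimple Λ)
    (b : Module.Basis (Fin 2) E (H1Q Λ)) {B : LinearMap.BilinForm ℚ (H1Q Λ)}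
    (hB : B ∈ formsBalanced Λ E) {z : ℂ} (hz : z.re ^ 2 + z.im ^ 2 = 1) :
    QGroup.Preserves ℝ B (mulC Λ z) := by
  intro x y
  have h1 := baseChange_mulC_I hE hg hT b hB
  have h2 : LinearMap.BilinForm.baseChange ℝ B (mulC Λ Complex.I x) y =
      - LinearMap.BilinForm.baseChange ℝ B x (mulC Λ Complex.I y) := by
    have h3 : mulC Λ Complex.I (mulC Λ Complex.I x) = -x :=
      LinearMap.congr_fun (mulC_I_mul_self Λ) x
    rw [← h1, h3, map_neg, LinearMap.neg_apply]
  rw [mulC_eq]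
  simp only [LinearMap.add_apply, LinearMap.smul_apply, Module.End.one_apply, map_add, map_smul,
    smul_eq_mul, h1, h2]
  linear_combination (LinearMap.BilinForm.baseChange ℝ B x y) * hz

end Balanced

theorem detComponent_mem_formsBalanced {E : Type*} [Field E] [NumberField E] [Module E (H1Q Λ)]
    (b : Module.Basis (Fin 2) E (H1Q Λ)) (l : E →ₗ[ℚ] ℚ) :
    QGroup.detComponent b l ∈ formsBalanced Λ E := by
  refine ⟨fun x => ?_, fun e x y => ?_⟩
  · rw [QGroup.detComponent_apply, mul_comm, sub_self, map_zero]
  · rw [QGroup.detComponent_apply, QGroup.detComponent_apply]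
    congr 1
    simp only [map_smul, Finsupp.smul_apply, smul_eq_mul]
    ring

end ComplexTorus

/-! ### Real tangent vectors lie in the real span of the Lie algebra. -/

namespace QGroup.AlgSubgroup

variable {W : Type*} [AddCommGroup W] [Module ℚ W] [Module.Finite ℚ W] (G : AlgSubgroup W)

/-- The Lie algebra of `G` as a subspace of `End_ℚ(W)`. -/
def lieSubmodule : Submodule ℚ (Module.End ℚ W) where
  carrier := G.lie
  zero_mem' := G.zero_mem_lie
  add_mem' := fun hX hY => G.add_mem_lie hX hY
  smul_mem' := fun c _ hX => G.smul_mem_lie c hX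

variable {G}

attribute [local instance] realOpModule

/-- The velocity `Y` is a tangent vector with real coefficients. Its rational components are
rational tangent vectors, and `Y` is a real combination of them. -/
theorem mem_span_lie_of_circle {Y : Module.End ℝ (ℝ ⊗[ℚ] W)}
    (hY : ∀ θ : ℝ, G.Mem (toMat ℝ (Real.cos θ • 1 + Real.sin θ • Y))) :
    Y ∈ Submodule.span ℝ ((fun X : Module.End ℚ W => X.baseChange ℝ) '' G.lie) := by
  have h1 : G.Tangent (toMat ℝ Y) := tangent_of_circle fun θ => by simpa using hY θ
  let n := Fin (Module.finrank ℚ W)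
  let F : (n × n → ℝ) →ₗ[ℝ] Module.End ℝ (ℝ ⊗[ℚ] W) :=
    (toMat ℝ).symm.toLinearMap ∘ₗ
      ((Matrix.ofLinearEquiv ℝ).toLinearMap ∘ₗ (LinearEquiv.curry ℝ ℝ n n).toLinearMap)
  have hF : ∀ M : Mat W ℝ, F (entries M) = (toMat ℝ).symm M := fun M => rfl
  have h2 := Submodule.mem_map_of_mem (f := F) (mem_span_rational_components (entries (toMat ℝ Y)))
  rw [hF, AlgEquiv.symm_apply_apply, Submodule.map_span, ← Set.range_comp] at h2
  refine Submodule.span_mono ?_ h2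
  rintro _ ⟨l, rfl⟩
  refine ⟨(LinearMap.toMatrixAlgEquiv (Module.finBasis ℚ W)).symm ((toMat ℝ Y).map l),
    G.mem_lie_iff.2 ?_, ?_⟩
  · rw [AlgEquiv.apply_symm_apply]
    exact h1.map l
  · apply (toMat ℝ).injective
    change _ = toMat ℝ (F (entries (((toMat ℝ Y).map l).map (algebraMap ℚ ℝ))))
    rw [hF, AlgEquiv.apply_symm_apply, toMat_baseChange, AlgEquiv.apply_symm_apply]

end QGroup.AlgSubgroup

/-! ### The Hodge group and its Lie algebra. -/

namespace ComplexTorus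

variable {V : Type*} [NormedAddCommGroup V] [NormedSpace ℂ V] [FiniteDimensional ℂ V]
  {Λ : Submodule ℤ V} [DiscreteTopology Λ] [IsZLattice ℝ Λ]

variable (Λ) in
theorem mulC_I_mem_span_lie : mulC Λ Complex.I ∈
    Submodule.span ℝ ((fun X : Module.End ℚ (H1Q Λ) => X.baseChange ℝ) '' (hodgeGroup Λ).lie) := by
  refine QGroup.AlgSubgroup.mem_span_lie_of_circle fun θ => ?_
  have h1 : h Λ (Circle.toUnits (Circle.exp θ)) ∈ (hodgeGroup Λ).pts ℝ := by
    simp only [hodgeGroup, QGroup.AlgSubgroup.sInf, Subgroup.mem_iInf]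
    exact fun G hG => hG _
  have h2 : ((h Λ (Circle.toUnits (Circle.exp θ)) :
      LinearMap.GeneralLinearGroup ℝ (H1R Λ)) : Module.End ℝ (H1R Λ)) =
      Real.cos θ • 1 + Real.sin θ • mulC Λ Complex.I := by
    change mulC Λ (Circle.exp θ : ℂ) = _
    rw [mulC_eq, Circle.coe_exp, Complex.exp_ofReal_mul_I_re, Complex.exp_ofReal_mul_I_im]
  rw [← h2]
  exact (QGroup.AlgSubgroup.mem_pts_iff _ _).1 h1

/-- Commutation passes to the real span of the Lie algebra, which contains `J`. This bounds the
commutant of the Lie algebra by `End⁰(T)` without any reductivity of the Hodge group. -/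
theorem mem_End0_of_commute {X : Module.End ℚ (H1Q Λ)}
    (hX : ∀ Y ∈ (hodgeGroup Λ).lie, X * Y = Y * X) : X ∈ End0 Λ := by
  have h1 : X.baseChange ℝ * mulC Λ Complex.I = mulC Λ Complex.I * X.baseChange ℝ := by
    have h2 := mulC_I_mem_span_lie Λ
    generalize mulC Λ Complex.I = J at h2
    induction h2 using Submodule.span_induction with
    | mem J hJ =>
      obtain ⟨Y, hY, rfl⟩ := hJ
      simp only
      rw [← LinearMap.baseChange_mul, hX Y hY, LinearMap.baseChange_mul]
    | zero => rw [mul_zero, zero_mul]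
    | add A B _ _ hA hB => rw [mul_add, add_mul, hA, hB]
    | smul c A _ hA => rw [mul_smul_comm, smul_mul_assoc, hA]
  intro z
  rw [mulC_eq, mul_add, add_mul, mul_smul_comm, mul_smul_comm, smul_mul_assoc, smul_mul_assoc, h1,
    mul_one, one_mul]

/-- For the same reason a rational subspace stable under the Lie algebra is a subtorus. -/
theorem mulC_I_mem_span_of_stable {U : Submodule ℚ (H1Q Λ)}
    (hU : ∀ X ∈ (hodgeGroup Λ).lie, ∀ u ∈ U, X u ∈ U) {u : H1Q Λ} (hu : u ∈ U) :
    mulC Λ Complex.I (1 ⊗ₜ u) ∈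
      Submodule.span ℝ ((fun w : H1Q Λ => ((1 : ℝ) ⊗ₜ[ℚ] w : H1R Λ)) '' U) := by
  have h2 := mulC_I_mem_span_lie Λ
  generalize mulC Λ Complex.I = J at h2
  induction h2 using Submodule.span_induction with
  | mem J hJ =>
    obtain ⟨Y, hY, rfl⟩ := hJ
    exact Submodule.subset_span ⟨Y u, hU Y hY u hu, rfl⟩
  | zero => exact zero_mem _
  | add A B _ _ hA hB => exact add_mem hA hB
  | smul c A _ hA => exact Submodule.smul_mem _ c hA

section

variable {E : Type*} [Field E] [NumberField E] [Module E (H1Q Λ)]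

theorem formStabilizer_mem (hg : 2 < Module.finrank ℂ V) (hT : IsTwoSimple Λ)
    (hE : (Algebra.lsmul ℚ ℚ (H1Q Λ) : E →ₐ[ℚ] Module.End ℚ (H1Q Λ)).range = End0 Λ)
    (b : Module.Basis (Fin 2) E (H1Q Λ)) (z : Circle) : h Λ (Circle.toUnits z) ∈
      (QGroup.formStabilizer (Set.range (QGroup.detComponent b : (E →ₗ[ℚ] ℚ) → _))).pts ℝ := by
  rintro _ ⟨l, rfl⟩
  refine preserves_mulC (fun e => hE ▸ ⟨e, rfl⟩) hg hT b (detComponent_mem_formsBalanced b l) ?_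
  have := Circle.normSq_coe z
  rw [Complex.normSq_apply] at this
  rw [sq, sq]
  exact this

/-- In the nilpotent alternative `[X, u]` is a multiple of `u` for every `X` in the Lie algebra, so
`ker u` is stable and hence a subtorus. 2-simplicity makes it zero, against `u² = 0` and `u ≠ 0`. -/
theorem hodgeGroup_lie_eq (hg : 2 < Module.finrank ℂ V) (hT : IsTwoSimple Λ)
    (hE : (Algebra.lsmul ℚ ℚ (H1Q Λ) : E →ₐ[ℚ] Module.End ℚ (H1Q Λ)).range = End0 Λ)
    (hd : Module.finrank ℚ E = Module.finrank ℂ V) (h2 : Module.finrank E (H1Q Λ) = 2)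
    (hsl : ∀ X ∈ (hodgeGroup Λ).lie, X ∈ slOver ℚ E (H1Q Λ)) :
    (hodgeGroup Λ).lie = (slOver ℚ E (H1Q Λ) : Set (Module.End ℚ (H1Q Λ))) := by
  have : Module.Finite E (H1Q Λ) := Module.finite_of_finrank_pos (by omega)
  rcases eq_slOver_or_exists h2 (hodgeGroup Λ).lieSubmodule
    (fun x hx y hy => (hodgeGroup Λ).bracket_mem_lie hx hy) hsl (fun z hz => by
      have := mem_End0_of_commute hz
      rw [← hE] at this
      obtain ⟨e, rfl⟩ := this
      exact ⟨e, fun w => rfl⟩) with h | ⟨u, hu0, huu, hx, -⟩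
  · exact h
  · exfalso
    let U : Submodule ℚ (H1Q Λ) := (LinearMap.ker u).restrictScalars ℚ
    have hU : U = ⊥ := by
      refine eq_bot_of_isTwoSimple hg hT (fun w hw => mulC_I_mem_span_of_stable ?_ hw) ?_
      · intro X hX w hw
        obtain ⟨c, hc⟩ := hx X hX
        have h3 := hc w
        have h4 : u w = 0 := hw
        rw [h4, map_zero, smul_zero, zero_sub, neg_eq_zero] at h3
        exact h3
      -- A proper `E`-subspace of the plane has `E`-dimension at most one, hence rank at most `[E :
      -- ℚ] = g`, which is the bound needed.
      · have h3 : Module.finrank E (LinearMap.ker u) < 2 := by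
          rw [← h2]
          refine Submodule.finrank_lt fun h => hu0 (LinearMap.ker_eq_top.1 h)
        have h4 : Module.finrank ℚ E * Module.finrank E (LinearMap.ker u) =
            Module.finrank ℚ U := Module.finrank_mul_finrank ℚ E (LinearMap.ker u)
        rw [← h4, hd]
        exact (Nat.mul_le_mul_left _ (by omega)).trans_eq (mul_one _)
    have hinj : Function.Injective u := by
      rw [injective_iff_map_eq_zero]
      intro w hw
      have : w ∈ U := hw
      rw [hU] at this
      exact this
    exact hu0 (LinearMap.ext fun w => hinj (by
      rw [LinearMap.zero_apply, map_zero]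
      exact LinearMap.congr_fun huu w))

/-- The Hodge group of a `2`-simple torus whose endomorphism algebra is a number field of degree
equal to the dimension. -/
theorem hodgeGroup_eq_resSL (hg : 2 < Module.finrank ℂ V) (hT : IsTwoSimple Λ)
    (hE : (Algebra.lsmul ℚ ℚ (H1Q Λ) : E →ₐ[ℚ] Module.End ℚ (H1Q Λ)).range = End0 Λ)
    (hd : Module.finrank ℚ E = Module.finrank ℂ V) :
    (∀ (R : Type) [CommRing R] [Algebra ℚ R],
      (hodgeGroup Λ).pts R = QGroup.resSL E (H1Q Λ) R) ∧
    (hodgeGroup Λ).lie = (slOver ℚ E (H1Q Λ) : Set (Module.End ℚ (H1Q Λ))) := by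
  have h2 : Module.finrank E (H1Q Λ) = 2 := by
    have := Module.finrank_mul_finrank ℚ E (H1Q Λ)
    rw [finrank_H1Q, hd, mul_comm 2] at this
    exact Nat.eq_of_mul_eq_mul_left (by omega) this
  have : Module.Finite E (H1Q Λ) := Module.finite_of_finrank_pos (by omega)
  let b := Module.finBasisOfFinrankEq E (H1Q Λ) h2
  have hpts : ∀ (R : Type) [CommRing R] [Algebra ℚ R],
      (hodgeGroup Λ).pts R ≤ QGroup.resSL E (H1Q Λ) R := by
    intro R _ _
    rw [QGroup.resSL_eq b]
    exact iInf₂_le (QGroup.formStabilizer _) (formStabilizer_mem hg hT hE b)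
  -- The inclusion of points over the dual numbers gives the trace zero condition on the Lie
  -- algebra.
  have hlie := hodgeGroup_lie_eq hg hT hE hd h2 fun X ⟨u, hu, hX⟩ =>
    QGroup.lie_le_slOver b ⟨u, by rw [← QGroup.resSL_eq b]; exact hpts _ hu, hX⟩
  refine ⟨fun R _ _ => le_antisymm (hpts R) ?_, hlie⟩
  exact QGroup.resSL_le (fun X hX => by rw [hlie]; exact hX) b

end

end ComplexTorus

end

theorem mainTheorem5 :
    -- The Hodge group of a `2`-simple torus `T = V/Λ` of dimension `g > 2` whose endomorphism
    -- algebra is a number field `E` of degree `g`.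
    (∀ (V : Type*) [NormedAddCommGroup V] [NormedSpace ℂ V] [FiniteDimensional ℂ V]
      (Λ : Submodule ℤ V) [DiscreteTopology Λ] [IsZLattice ℝ Λ]
      (E : Type*) [Field E] [NumberField E] [Module E (ComplexTorus.H1Q Λ)],
      2 < Module.finrank ℂ V →
      ComplexTorus.IsTwoSimple Λ →
      -- the action of `E` on `H₁(T, ℚ)` identifies `E` with `End⁰(T)`
      (Algebra.lsmul ℚ ℚ (ComplexTorus.H1Q Λ) :
        E →ₐ[ℚ] Module.End ℚ (ComplexTorus.H1Q Λ)).range = ComplexTorus.End0 Λ →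
      Module.finrank ℚ E = Module.finrank ℂ V →
      (∀ (R : Type) [CommRing R] [Algebra ℚ R],
        (ComplexTorus.hodgeGroup Λ).pts R = QGroup.resSL E (ComplexTorus.H1Q Λ) R) ∧
      (ComplexTorus.hodgeGroup Λ).lie =
        (slOver ℚ E (ComplexTorus.H1Q Λ) : Set (Module.End ℚ (ComplexTorus.H1Q Λ)))) ∧
    -- A semisimple Lie algebra of operators in a `2g`-dimensional space `W` whose centralizer
    -- is a field `K` of degree `g`.
    (∀ (g : ℕ) (k : Type*) [Field k] [CharZero k] (K : Type*) [Field K] [Algebra k K]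
      (W : Type*) [AddCommGroup W] [Module k W] [Module K W] [IsScalarTower k K W]
      (𝔤 : LieSubalgebra k (Module.End k W)),
      0 < g →
      Module.finrank k W = 2 * g →
      LieAlgebra.IsSemisimple k 𝔤 →
      -- the action of `K` on `W` identifies `K` with the centralizer of `𝔤`
      (Algebra.lsmul k k W : K →ₐ[k] Module.End k W).range =
        Subalgebra.centralizer k (𝔤 : Set (Module.End k W)) →
      Module.finrank k K = g →
      𝔤 = slOver k K W) := by
  exact ⟨fun V _ _ _ Λ _ _ E _ _ _ hg hT hE hd => ComplexTorus.hodgeGroup_eq_resSL hg hT hE hd,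
    fun g k _ _ K _ _ W _ _ _ _ 𝔤 hg hW hss hc hK => eq_slOver_of_isSemisimple 𝔤 hg hW hss hc hK⟩
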